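/- Let $\mathfrak g$ be a real split semisimple Lie algebra of rank $l$ with split Cartan subalgebra $\mathfrak h$, root system $\Delta$, simple roots $\Pi=\{\alpha_1,\dots,\alpha_l\}$, coroots $h_\alpha$ and Weyl group $W$. Let $H_{\mathbb R}$ be the Cartan subgroup of the adjoint-type group, i.e. the group of automorphisms of $\mathfrak g$ that fix $\mathfrak h$ pointwise, and for a root $\varphi$ let $\chi_\varphi(h)\in\mathbb R^*$ be the scalar by which $h\in H_{\mathbb R}$ acts on the root space of $\varphi$. Let $W$ act on $H_{\mathbb R}$ by $\chi_\varphi(wh)=\chi_{w^{-1}\varphi}(h)$. For $\epsilon\in\mathcal E=\{\pm1\}^l$ put $$H_\epsilon^-=\{h\in H_{\mathbb R}:\ |\chi_{-\alpha_i}(h)|\le 1,\ \operatorname{sign}\chi_{\alpha_i}(h)=\epsilon_i\ (1\le i\le l)\}.$$ For $A\subset\Pi$ let $H_\epsilon^A=h\exp\big(\operatorname{Span}\{h_{\alpha_i}:\alpha_i\notin A\}\big)$, where $h\in H_{\mathbb R}$ is the element with $\chi_{\alpha_i}(h)=\epsilon_i$ for $\alpha_i\notin A$ and $\chi_{\alpha_i}(h)=1$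 for $\alpha_i\in A$, and let $$H_\epsilon^{A,-}=\{h\in H_\epsilon^A:\ |\chi_{-\alpha_i}(h)|\le1\ \text{ for all }\alpha_i\notin A\}.$$ Let $\mathbb P=(\mathbb R\cup\{\infty\})^{\Delta}$, a product of real projective lines, on which $W$ acts by $(wp)_\varphi=p_{w^{-1}\varphi}$, and map $H_{\mathbb R}$ to $\mathbb P$ by $h\mapsto(\chi_\varphi(h))_{\varphi\in\Delta}$. An element $h\in H_\epsilon^{A,-}$ is regarded as the point of $\mathbb P$ with $\varphi$-coordinate $\chi_\varphi(h)$ if no simple root in $A$ occurs in $\varphi$ and, otherwise, $\infty$ if $\varphi$ is positive and $0$ if $\varphi$ is negative (so that $\chi_{-\alpha_i}=0$ for $\alpha_i\in A$). Let $\overline{H_\epsilon^-}$ be the closure of $H_\epsilon^-$ in $\mathbb P$, let $\epsilon(w)_i=\prod_j\epsilon_j^{c_{ij}}$ where $w\alpha_i=\sum_jc_{ij}\alpha_j$, and let $$\hat H_{\mathbb R}=\bigcup_{\epsilon\in\mathcal E}\ \bigcup_{w\in W}w\big(\overline{H_{\epsilon(w)}^-}\big).$$ **Proposition 2.1.** 1.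 For every $\epsilon$, $\overline{H_\epsilon^-}=\bigcup_{A\subset\Pi}H_\epsilon^{A,-}$, and $\overline{H_\epsilon^-}$ is homeomorphic to the box $\{(t_1,\dots,t_l)\in\mathbb R^l:-1\le t_j\le1\}$. 2. $\hat H_{\mathbb R}$ is compact; the map $H_{\mathbb R}\to\mathbb P$ is injective, and $\hat H_{\mathbb R}$ is the closure of its image; and the image of $H_{\mathbb R}$ is invariant under $W$. 3. $\hat H_{\mathbb R}$ has the structure of a smooth manifold of dimension $l$ on which $W$ acts by diffeomorphisms, the action being the restriction of that on $\mathbb P$ (so it extends the action on $H_{\mathbb R}$). The functions $\chi_{-\alpha_1},\dots,\chi_{-\alpha_l}$ are the coordinates of a smooth chart whose domain contains every $\overline{H_\epsilon^-}$ and which maps it onto $\{t\in\mathbb R^l: 0\le\epsilon_jt_j\le1\}$. For each $\epsilon$ there is also a smooth chart whose domain contains $\overline{H_\epsilon^-}$ and which maps it onto the box $[-1,1]^l$. -/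

import Mathlib

open Set
open scoped Manifold ContDiff

namespace TodaVariety

noncomputable section

section Definitions

variable {𝔤 : Type*} [LieRing 𝔤] [LieAlgebra ℝ 𝔤] [FiniteDimensional ℝ 𝔤]
  [LieAlgebra.IsSemisimple ℝ 𝔤]
  (𝔥 : LieSubalgebra ℝ 𝔤) [𝔥.IsCartanSubalgebra] [LieModule.IsTriangularizable ℝ 𝔥 𝔤]

/-- The root system `Δ` of the split pair `(𝔤, 𝔥)`; its index type is the set `𝔥.root` of roots,
its coroots are the elements `h_α ∈ 𝔥`, so that `C i j = α i (h_{α j})`. -/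
abbrev rootSys : RootPairing 𝔥.root ℝ (Module.Dual ℝ 𝔥) 𝔥 :=
  LieAlgebra.IsKilling.rootSystem 𝔥

/-- The Weyl group `W`. -/
abbrev Weyl : Type _ := (rootSys 𝔥).weylGroup

/-- The root `w φ`. -/
def weylRoot (w : Weyl 𝔥) (φ : 𝔥.root) : 𝔥.root := (rootSys 𝔥).weylGroupToPerm w φ

/-- The root `-φ = s_φ φ`. -/
def negRoot (φ : 𝔥.root) : 𝔥.root := (rootSys 𝔥).reflectionPerm φ φ

/-- The Cartan subgroup `H_ℝ`: the centralizer of the split Cartan subalgebra `𝔥` in the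
automorphism group of `𝔤`, that is, the automorphisms of `𝔤` fixing `𝔥` pointwise. It is the
group of real points of the maximal torus of the adjoint group. For `𝔤 = 𝔰𝔩(n, ℝ)` these are the
conjugations by real invertible diagonal matrices: the diagonal subgroup of `SL(n, ℝ)` for `n` odd
and that of `Ad (SL(n, ℝ)^±)` for `n` even. -/
def CartanGroup : Type _ := {g : 𝔤 ≃ₗ⁅ℝ⁆ 𝔤 // ∀ x : 𝔥, g (x : 𝔤) = x}

variable {𝔥}

/-- An element of `H_ℝ` acts on each (one-dimensional) root space by a scalar. -/
theorem CartanGroup.exists_scalar (h : CartanGroup 𝔥) (φ : 𝔥.root) :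
    ∃ c : ℝ, ∀ y ∈ LieAlgebra.rootSpace 𝔥 φ.1, h.1 y = c • y := by
  have hφ : φ.1.IsNonZero := LieSubalgebra.isNonZero_coe_root φ
  have h1 := LieAlgebra.IsKilling.finrank_rootSpace_eq_one φ.1 hφ
  have hmaps : ∀ y ∈ LieAlgebra.rootSpace 𝔥 φ.1, h.1 y ∈ LieAlgebra.rootSpace 𝔥 φ.1 := by
    intro y hy
    refine LieModule.weightSpace_le_genWeightSpace 𝔤 _ ?_
    rw [LieModule.mem_weightSpace]
    intro x
    have hx : ⁅(x : 𝔤), y⁆ = φ.1 x • y := LieAlgebra.IsKilling.lie_eq_smul_of_mem_rootSpace hy x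
    have := congrArg h.1 hx
    rw [LieEquiv.map_lie, h.2 x, map_smul] at this
    exact this
  obtain ⟨v, hv, hspan⟩ := finrank_eq_one_iff'.mp h1
  obtain ⟨c, hc⟩ := hspan ⟨h.1 v, hmaps v v.2⟩
  refine ⟨c, fun y hy => ?_⟩
  obtain ⟨d, hd⟩ := hspan ⟨y, hy⟩
  have hc' : c • (v : 𝔤) = h.1 v := congrArg Subtype.val hc
  have hd' : d • (v : 𝔤) = y := congrArg Subtype.val hd
  rw [← hd', map_smul, ← hc', smul_comm]

/-- The group character `χ_φ`: the scalar by which `h ∈ H_ℝ` acts on the root space of `φ`. -/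
def char (h : CartanGroup 𝔥) (φ : 𝔥.root) : ℝ := (h.exists_scalar φ).choose

theorem char_spec (h : CartanGroup 𝔥) (φ : 𝔥.root) :
    ∀ y ∈ LieAlgebra.rootSpace 𝔥 φ.1, h.1 y = char h φ • y :=
  (h.exists_scalar φ).choose_spec

/-- `h = exp x` for `x ∈ 𝔥`: the element `exp (ad x)` of `H_ℝ` acts on the root space of `φ` by
`e^{φ(x)}`. -/
def IsExp (x : 𝔥) (h : CartanGroup 𝔥) : Prop :=
  ∀ φ : 𝔥.root, ∀ y ∈ LieAlgebra.rootSpace 𝔥 φ.1, h.1 y = Real.exp (φ.1 x) • y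

variable (𝔥) in
/-- The space in which the closures are taken: families of values in `ℝ ∪ {∞} = ℝP¹`, one for
each root, with the product topology. As every root is a `W`-translate `-w α_i`, the coordinates
are the functions `b_i = χ_{-α_i}` and their Weyl translates, allowed to vanish (subsystems) and
to be infinite (blow-ups). -/
abbrev Ambient : Type _ := 𝔥.root → OnePoint ℝ

/-- The embedding of `H_ℝ` by all its root characters. -/
def embed (h : CartanGroup 𝔥) : Ambient 𝔥 := fun φ => ((char h φ : ℝ) : OnePoint ℝ)

/-- The action of the Weyl group through the action on the characters, `w χ_φ = χ_{wφ}`: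
the point `w p` has the coordinate `p (w⁻¹ φ)` at `φ`. -/
def weylAct (w : Weyl 𝔥) (p : Ambient 𝔥) : Ambient 𝔥 := fun φ => p (weylRoot 𝔥 w⁻¹ φ)

variable (b : (rootSys 𝔥).Base)

/-- The coefficient of the simple root `α_j` in the root `φ`. -/
def simpleCoeff (φ : 𝔥.root) (j : b.support) : ℤ :=
  b.toWeightBasisInt.repr ((rootSys 𝔥).rootSpanMem ℤ φ) j

/-- The set `𝓔` of signs `ε = (ε_1, …, ε_l)`. -/
abbrev Signs : Type _ := b.support → ℤˣ

variable {b} in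
/-- The signs `ε(w)`, with `ε(w)_i = χ_{w α_i}(h_ε)`; for `w = s_{α_i}` this is
`ε'_j = ε_j ε_i^{-C_{j,i}}`. -/
def Signs.translate (ε : Signs b) (w : Weyl 𝔥) : Signs b :=
  fun i => ∏ j, ε j ^ simpleCoeff b (weylRoot 𝔥 w i) j

/-- The antidominant chamber piece `H_ε^-`. -/
def chamber (ε : Signs b) : Set (CartanGroup 𝔥) :=
  {h | ∀ i : b.support, |char h (negRoot 𝔥 i)| ≤ 1 ∧
    Real.sign (char h i) = ((ε i : ℤ) : ℝ)}

/-- `𝔥^A`, the span of the `h_{α_i}` with `α_i ∉ A`. -/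
def subAlgebra (A : Set b.support) : Submodule ℝ 𝔥 :=
  Submodule.span ℝ {x | ∃ i : b.support, i ∉ A ∧ x = (rootSys 𝔥).coroot i}

open Classical in
/-- The component `H_ε^A = h_ε exp 𝔥^A` of the Cartan subgroup of the subsystem of `A`. The element
`h_ε` has `χ_{α_i}(h_ε) = ε_i` for `α_i ∉ A`, and `χ_{α_i}(h_ε) = 1` for `α_i ∈ A`. -/
def subGroup (A : Set b.support) (ε : Signs b) : Set (CartanGroup 𝔥) :=
  {h | ∃ hε k : CartanGroup 𝔥,
    (∀ i : b.support, char hε i = if i ∈ A then 1 else ((ε i : ℤ) : ℝ)) ∧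
    (∃ x ∈ subAlgebra b A, IsExp x k) ∧
    ∀ y : 𝔤, h.1 y = hε.1 (k.1 y)}

/-- The piece `H_ε^{A,-}`: the elements of `H_ε^A` in the antidominant chamber of the subsystem,
whose simple roots are the `α_i ∉ A`. -/
def subChamber (A : Set b.support) (ε : Signs b) : Set (CartanGroup 𝔥) :=
  {h ∈ subGroup b A ε | ∀ i : b.support, i ∉ A → |char h (negRoot 𝔥 i)| ≤ 1}

open Classical in
/-- How an element of the Cartan subgroup of the subsystem of `A` is added as a point: `b_i = 0` for
`α_i ∈ A`, and `b_i = χ_{-α_i}(h)` for `α_i ∉ A`. Thus roots of the subsystem (those without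
simple roots of `A`) keep the value `χ_φ(h)`; other roots have the value `∞` if they are positive
and `0` if they are negative. -/
def subEmbed (A : Set b.support) (h : CartanGroup 𝔥) : Ambient 𝔥 := fun φ =>
  if ∀ j ∈ A, simpleCoeff b φ j = 0 then ((char h φ : ℝ) : OnePoint ℝ)
  else if b.IsPos φ then OnePoint.infty
  else ((0 : ℝ) : OnePoint ℝ)

/-- The closure of `H_ε^-`. -/
def closedChamber (ε : Signs b) : Set (Ambient 𝔥) := closure (embed '' chamber b ε)

/-- The compactification `Ĥ_ℝ`, the union of the Weyl translates `w (closure of H_{ε(w)}^-)`. -/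
def Hhat : Set (Ambient 𝔥) :=
  ⋃ ε : Signs b, ⋃ w : Weyl 𝔥, weylAct w '' closedChamber b (ε.translate w)

/-- The part of `Ĥ_ℝ` lying in the closure of `H_ε^-` (that is, all of this closure). -/
def chamberInHhat (ε : Signs b) : Set (Hhat b) := {p | (p : Ambient 𝔥) ∈ closedChamber b ε}

end Definitions

end

end TodaVariety

namespace TodaVariety

set_option linter.unusedSectionVars false

noncomputable section

variable {𝔤 : Type*} [LieRing 𝔤] [LieAlgebra ℝ 𝔤] [FiniteDimensional ℝ 𝔤]
  [LieAlgebra.IsSemisimple ℝ 𝔤]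
  {𝔥 : LieSubalgebra ℝ 𝔤} [𝔥.IsCartanSubalgebra] [LieModule.IsTriangularizable ℝ 𝔥 𝔤]

/-! ### Coefficients of roots with respect to a base -/

section Coefficients

variable (b : (rootSys 𝔥).Base)

/-! Everything is expressed in the coordinates `t_i = χ_{-α_i}`. An automorphism fixing `𝔥`
pointwise is a family of root characters respecting sums and negatives, and every such family occurs
(`CartanGroup.ext_char`, `IsMultiplicative.exists_char_eq`). The values on the simple roots are free
and determine the rest (`IsMultiplicative.eq_prod`), so `H_ℝ` is the set of `t` with all `t_i ≠ 0`.

For a negative root, `χ_φ` is a monomial in `t` with nonnegative exponents; for a positive root it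
is the inverse of one. Inversion is continuous from `ℝ` to the projective line, so the embedding
extends to a continuous injection `param` of all of `ℝ^l` (`embed_eq_param`). A chamber is the image
of a half-open box with compact closure, hence its closure is the image of the closed box
(`closedChamber_eq`). The strata indexed by `A` are the loci where exactly the `t_i` with `α_i ∈ A`
vanish.

Applying `exists_weyl_dominant` to `log |χ|` moves each element of `H_ℝ` into a chamber. Since `Ĥ_ℝ`
is a finite union of compact sets, it is therefore the closure of `H_ℝ` (`closure_range_embed`). On
that closure `param` inverts the coordinates wherever they are finite (`param_affineCoord`), so its
Weyl translates are charts, and they cover. Their transition functions are finite coordinates of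
`param`, that is, monomials or inverses of nonvanishing monomials (`contDiffAt_affineCoord_param`).
A Weyl element permutes these charts without changing the coordinates, so it acts smoothly. -/

theorem root_eq_sum (φ : 𝔥.root) :
    (rootSys 𝔥).root φ = ∑ j : b.support, simpleCoeff b φ j • (rootSys 𝔥).root j := by
  have h := congrArg Subtype.val (b.toWeightBasisInt.sum_repr ((rootSys 𝔥).rootSpanMem ℤ φ))
  rw [AddSubmonoidClass.coe_finsetSum] at h
  simpa [simpleCoeff] using h.symm

theorem simpleCoeff_eq_of_root_eq_sum {φ : 𝔥.root} {n : b.support → ℤ}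
    (h : (rootSys 𝔥).root φ = ∑ j : b.support, n j • (rootSys 𝔥).root j) (j : b.support) :
    simpleCoeff b φ j = n j := by
  have hli := b.linearIndepOn_root.restrict_scalars' ℤ
  rw [root_eq_sum b φ] at h
  exact Fintype.linearIndependent_iffₛ.mp hli _ _ h j

theorem simpleCoeff_simple [DecidableEq b.support] (i j : b.support) :
    simpleCoeff b i j = if j = i then 1 else 0 :=
  simpleCoeff_eq_of_root_eq_sum b (n := fun j => if j = i then 1 else 0) (by simp [ite_smul]) j

theorem root_negRoot (φ : 𝔥.root) :
    (rootSys 𝔥).root (negRoot 𝔥 φ) = -(rootSys 𝔥).root φ := by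
  rw [negRoot, RootPairing.root_reflectionPerm, RootPairing.reflection_apply_self]

theorem simpleCoeff_negRoot (φ : 𝔥.root) (j : b.support) :
    simpleCoeff b (negRoot 𝔥 φ) j = -simpleCoeff b φ j :=
  simpleCoeff_eq_of_root_eq_sum b (n := fun j => -simpleCoeff b φ j)
    (by rw [root_negRoot, root_eq_sum b φ]; simp) j

theorem simpleCoeff_add {φ ψ θ : 𝔥.root}
    (h : (rootSys 𝔥).root θ = (rootSys 𝔥).root φ + (rootSys 𝔥).root ψ) (j : b.support) :
    simpleCoeff b θ j = simpleCoeff b φ j + simpleCoeff b ψ j :=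
  simpleCoeff_eq_of_root_eq_sum b (n := fun j => simpleCoeff b φ j + simpleCoeff b ψ j)
    (by rw [h, root_eq_sum b φ, root_eq_sum b ψ]; simp [add_smul, Finset.sum_add_distrib]) j

theorem height_eq_sum_simpleCoeff (φ : 𝔥.root) :
    b.height φ = ∑ j : b.support, simpleCoeff b φ j := by
  obtain ⟨f, -, -, hf⟩ := b.exists_root_eq_sum_int φ
  rw [RootPairing.Base.height_eq_sum hf, ← Finset.sum_coe_sort b.support f]
  refine Finset.sum_congr rfl fun j _ => (simpleCoeff_eq_of_root_eq_sum b (n := fun j => f j) ?_ j).symm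
  rw [hf, ← Finset.sum_coe_sort b.support fun j => f j • (rootSys 𝔥).root j]

theorem simpleCoeff_sign (φ : 𝔥.root) :
    (∀ j, 0 ≤ simpleCoeff b φ j) ∨ ∀ j, simpleCoeff b φ j ≤ 0 := by
  obtain ⟨f, -, hs, hf⟩ := b.exists_root_eq_sum_int φ
  have h : ∀ j : b.support, simpleCoeff b φ j = f j :=
    simpleCoeff_eq_of_root_eq_sum b (n := fun j => f j)
      (by rw [hf, ← Finset.sum_coe_sort b.support fun j => f j • (rootSys 𝔥).root j])
  rcases hs with hs | hs
  · exact Or.inl fun j => (h j).symm ▸ hs.le j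
  · exact Or.inr fun j => (h j).symm ▸ hs.le j

theorem simpleCoeff_nonneg {φ : 𝔥.root} (hφ : b.IsPos φ) (j : b.support) :
    0 ≤ simpleCoeff b φ j := by
  rcases simpleCoeff_sign b φ with h | h
  · exact h j
  · have : b.height φ ≤ 0 := height_eq_sum_simpleCoeff b φ ▸ Finset.sum_nonpos fun j _ => h j
    exact absurd hφ (not_lt.mpr this)

theorem simpleCoeff_nonpos {φ : 𝔥.root} (hφ : ¬ b.IsPos φ) (j : b.support) :
    simpleCoeff b φ j ≤ 0 := by
  rcases simpleCoeff_sign b φ with h | h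
  · have : 0 ≤ b.height φ := height_eq_sum_simpleCoeff b φ ▸ Finset.sum_nonneg fun j _ => h j
    exact absurd ((b.isPos_iff' (i := φ)).mpr this) hφ
  · exact h j

theorem not_isPos_negRoot (i : b.support) : ¬ b.IsPos (negRoot 𝔥 i) := by
  classical
  intro h
  have := simpleCoeff_nonneg b h i
  rw [simpleCoeff_negRoot, simpleCoeff_simple] at this
  simp at this

end Coefficients

/-! ### The Weyl group -/

section Weyl

theorem root_weylRoot (w : Weyl 𝔥) (φ : 𝔥.root) :
    (rootSys 𝔥).root (weylRoot 𝔥 w φ) = w • (rootSys 𝔥).root φ :=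
  ((rootSys 𝔥).weylGroup_apply_root w φ).symm

theorem weylRoot_one (φ : 𝔥.root) : weylRoot 𝔥 1 φ = φ := by
  simp [weylRoot]

theorem weylRoot_mul (v w : Weyl 𝔥) (φ : 𝔥.root) :
    weylRoot 𝔥 (v * w) φ = weylRoot 𝔥 v (weylRoot 𝔥 w φ) := by
  simp only [weylRoot, map_mul, Equiv.Perm.mul_apply]

theorem weylRoot_inv_weylRoot (w : Weyl 𝔥) (φ : 𝔥.root) :
    weylRoot 𝔥 w⁻¹ (weylRoot 𝔥 w φ) = φ := by
  rw [← weylRoot_mul, inv_mul_cancel, weylRoot_one]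

theorem weylRoot_weylRoot_inv (w : Weyl 𝔥) (φ : 𝔥.root) :
    weylRoot 𝔥 w (weylRoot 𝔥 w⁻¹ φ) = φ := by
  rw [← weylRoot_mul, mul_inv_cancel, weylRoot_one]

theorem weylRoot_negRoot (w : Weyl 𝔥) (φ : 𝔥.root) :
    weylRoot 𝔥 w (negRoot 𝔥 φ) = negRoot 𝔥 (weylRoot 𝔥 w φ) :=
  (rootSys 𝔥).root.injective (by
    rw [root_weylRoot, root_negRoot, root_negRoot, root_weylRoot, smul_neg])

theorem weylRoot_add {φ ψ θ : 𝔥.root}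
    (h : (rootSys 𝔥).root θ = (rootSys 𝔥).root φ + (rootSys 𝔥).root ψ) (w : Weyl 𝔥) :
    (rootSys 𝔥).root (weylRoot 𝔥 w θ) =
      (rootSys 𝔥).root (weylRoot 𝔥 w φ) + (rootSys 𝔥).root (weylRoot 𝔥 w ψ) := by
  simp only [root_weylRoot, h, smul_add]

/-- The roots span, so a Weyl element is determined by its permutation of the finitely many roots.
-/
instance : Finite (Weyl 𝔥) := by
  refine Finite.of_injective (fun w : Weyl 𝔥 => weylRoot 𝔥 w) fun v w hvw => ?_
  refine Subtype.ext (RootPairing.Equiv.weightHom_injective _ ?_)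
  refine LinearEquiv.toLinearMap_injective ?_
  refine LinearMap.ext_on (RootPairing.IsRootSystem.span_root_eq_top (P := rootSys 𝔥)) ?_
  rintro _ ⟨φ, rfl⟩
  have h := congrArg (rootSys 𝔥).root (congrFun hvw φ)
  rw [root_weylRoot, root_weylRoot] at h
  exact h

variable (b : (rootSys 𝔥).Base)

/-- Every linear functional is dominant on the simple roots of some Weyl chamber. -/
theorem exists_weyl_dominant (u : b.support → ℝ) :
    ∃ w : Weyl 𝔥, ∀ i : b.support,
      0 ≤ ∑ j, (simpleCoeff b (weylRoot 𝔥 w i) j : ℝ) * u j := by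
  classical
  let ξ : Module.Dual ℝ 𝔥 →ₗ[ℝ] ℝ := b.toWeightBasis.constr ℝ u
  -- The value `1` on every simple coroot gives `s_i ρ = ρ - α_i`.
  let ρ : Module.Dual ℝ 𝔥 := b.toCoweightBasis.constr ℝ fun _ => (1 : ℝ)
  have hξ : ∀ i : b.support, ξ ((rootSys 𝔥).root i) = u i := fun i => by
    have := b.toWeightBasis.constr_basis ℝ u i
    rwa [RootPairing.Base.toWeightBasis_apply] at this
  have hρ : ∀ i : b.support, ρ ((rootSys 𝔥).coroot i) = 1 := fun i => by
    have := b.toCoweightBasis.constr_basis ℝ (fun _ => (1 : ℝ)) i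
    rwa [RootPairing.Base.toCoweightBasis_apply] at this
  -- At a maximum of `ξ` on the orbit of `ρ`, comparing `w` with `w s_i` leaves exactly `ξ (w α_i) ≥
  -- 0`.
  obtain ⟨w, hw⟩ := Finite.exists_max fun w : Weyl 𝔥 => ξ (w • ρ)
  refine ⟨w, fun i => ?_⟩
  have h := hw (w * RootPairing.weylGroup.ofIdx (rootSys 𝔥) i)
  have hs : RootPairing.weylGroup.ofIdx (rootSys 𝔥) i.1 • ρ = ρ - (rootSys 𝔥).root i := by
    rw [RootPairing.weylGroup.ofIdx_smul, RootPairing.Equiv.reflection_smul,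
      RootPairing.reflection_apply]
    have : (rootSys 𝔥).coroot' i ρ = 1 := hρ i
    rw [this, one_smul]
  rw [mul_smul, hs, smul_sub, map_sub, ← root_weylRoot, root_eq_sum b, map_sum] at h
  simp only [map_zsmul, hξ, zsmul_eq_mul] at h
  linarith

end Weyl

/-! ### Characters of the Cartan subgroup -/

section Characters

theorem char_eq_of_map_eq_smul {h : CartanGroup 𝔥} {φ : 𝔥.root} {y : 𝔤} {c : ℝ}
    (hy : y ∈ LieAlgebra.rootSpace 𝔥 φ.1) (hy0 : y ≠ 0) (hc : h.1 y = c • y) :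
    char h φ = c :=
  smul_left_injective ℝ hy0 ((char_spec h φ y hy).symm.trans hc)

theorem char_ne_zero (h : CartanGroup 𝔥) (φ : 𝔥.root) : char h φ ≠ 0 := by
  obtain ⟨y, hy, hy0⟩ := φ.1.exists_ne_zero
  intro h0
  have := char_spec h φ y hy
  rw [h0, zero_smul] at this
  exact hy0 (h.1.injective (this.trans (map_zero h.1).symm))

theorem coe_negRoot (φ : 𝔥.root) : ((negRoot 𝔥 φ).1 : 𝔥 → ℝ) = -(φ.1 : 𝔥 → ℝ) :=
  funext fun x => LinearMap.congr_fun (root_negRoot φ) x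

/-- In an `𝔰𝔩₂`-triple for `φ`, the bracket `⁅e, f⁆` is a nonzero element of `𝔥`, which `h` fixes;
comparing scalars gives `χ_φ χ_{-φ} = 1`. -/
theorem char_negRoot (h : CartanGroup 𝔥) (φ : 𝔥.root) :
    char h (negRoot 𝔥 φ) = (char h φ)⁻¹ := by
  have hφ := LieSubalgebra.isNonZero_coe_root φ
  obtain ⟨x, e, f, ht, he, hf⟩ := LieAlgebra.IsKilling.exists_isSl2Triple_of_weight_isNonZero hφ
  have hx := ht.h_eq_coroot hφ he hf
  have hf' : f ∈ LieAlgebra.rootSpace 𝔥 (negRoot 𝔥 φ).1 := by rwa [coe_negRoot]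
  have h1 : h.1 x = x := by rw [hx]; exact h.2 _
  rw [← ht.lie_e_f, LieEquiv.map_lie, char_spec h φ e he, char_spec h _ f hf', smul_lie, lie_smul,
    smul_smul, ht.lie_e_f] at h1
  have h2 := smul_left_injective ℝ ht.h_ne_zero (h1.trans (one_smul ℝ x).symm)
  exact eq_inv_of_mul_eq_one_right h2

theorem coe_eq_add {φ ψ θ : 𝔥.root}
    (h : (rootSys 𝔥).root θ = (rootSys 𝔥).root φ + (rootSys 𝔥).root ψ) :
    (θ.1 : 𝔥 → ℝ) = φ.1 + ψ.1 :=
  funext fun x => LinearMap.congr_fun h x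

/-- It suffices to find a nonzero bracket linking the root spaces: either `⁅e, x⁆` in that of `θ`,
or `⁅f, y⁆` in that of `ψ`. Representation theory of `𝔰𝔩₂` excludes that both vanish. -/
theorem char_add {φ ψ θ : 𝔥.root}
    (hθ : (rootSys 𝔥).root θ = (rootSys 𝔥).root φ + (rootSys 𝔥).root ψ) (h : CartanGroup 𝔥) :
    char h θ = char h φ * char h ψ := by
  have hφ := LieSubalgebra.isNonZero_coe_root φ
  have hcoe := coe_eq_add hθ
  obtain ⟨t, e, f, ht, he, hf⟩ := LieAlgebra.IsKilling.exists_isSl2Triple_of_weight_isNonZero hφ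
  have htc := ht.h_eq_coroot hφ he hf
  obtain ⟨x, hx, hx0⟩ := ψ.1.exists_ne_zero
  obtain ⟨y, hy, hy0⟩ := θ.1.exists_ne_zero
  have hf' : f ∈ LieAlgebra.rootSpace 𝔥 (negRoot 𝔥 φ).1 := by rwa [coe_negRoot]
  by_cases hex : ⁅e, x⁆ = 0
  · have hlx : ⁅t, x⁆ = ψ.1 (LieAlgebra.IsKilling.coroot φ.1) • x := by
      rw [htc]; exact LieAlgebra.IsKilling.lie_eq_smul_of_mem_rootSpace hx _
    have hly : ⁅t, y⁆ = θ.1 (LieAlgebra.IsKilling.coroot φ.1) • y := by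
      rw [htc]; exact LieAlgebra.IsKilling.lie_eq_smul_of_mem_rootSpace hy _
    -- A vector killed by `e` has weight `n ≥ 0`, so `y` has weight `n + 2 > 0`, whereas a vector
    -- killed by `f` has weight at most `0`.
    obtain ⟨n, hn⟩ := IsSl2Triple.HasPrimitiveVectorWith.exists_nat (t := ht) ⟨hx0, hlx, hex⟩
    have h2 : θ.1 (LieAlgebra.IsKilling.coroot φ.1) = 2 + n := by
      rw [← hn, hcoe, Pi.add_apply, LieAlgebra.IsKilling.root_apply_coroot hφ]
    have hfy : ⁅f, y⁆ ≠ 0 := fun hfy => by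
      obtain ⟨m, hm⟩ := IsSl2Triple.HasPrimitiveVectorWith.exists_nat (t := ht.symm)
        (μ := -(2 + n : ℝ)) ⟨hy0, by rw [neg_lie, hly, h2, neg_smul], hfy⟩
      have : (0 : ℝ) ≤ m := m.cast_nonneg
      have : (0 : ℝ) ≤ n := n.cast_nonneg
      linarith
    have hmem : ⁅f, y⁆ ∈ LieAlgebra.rootSpace 𝔥 ψ.1 := by
      have := LieAlgebra.lie_mem_genWeightSpace_of_mem_genWeightSpace hf hy
      rwa [hcoe, neg_add_cancel_left] at this
    have := char_eq_of_map_eq_smul (h := h) hmem hfy (c := (char h φ)⁻¹ * char h θ) (by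
      rw [LieEquiv.map_lie, char_spec h _ f hf', char_spec h θ y hy, char_negRoot, smul_lie,
        lie_smul, smul_smul])
    rw [this, mul_inv_cancel_left₀ (char_ne_zero h φ)]
  · have hmem : ⁅e, x⁆ ∈ LieAlgebra.rootSpace 𝔥 θ.1 := by
      have := LieAlgebra.lie_mem_genWeightSpace_of_mem_genWeightSpace he hx
      rwa [← hcoe] at this
    exact char_eq_of_map_eq_smul hmem hex (by
      rw [LieEquiv.map_lie, char_spec h φ e he, char_spec h ψ x hx, smul_lie, lie_smul, smul_smul])

theorem map_eq_of_mem_rootSpace_zero (h : CartanGroup 𝔥) {y : 𝔤}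
    (hy : y ∈ LieAlgebra.rootSpace 𝔥 (0 : 𝔥 → ℝ)) : h.1 y = y := by
  have : y ∈ 𝔥 := by
    have h1 := LieAlgebra.rootSpace_zero_eq ℝ 𝔤 𝔥
    rw [h1] at hy
    exact hy
  exact h.2 ⟨y, this⟩

theorem mem_iSup_rootSpace (y : 𝔤) :
    y ∈ ⨆ χ : LieModule.Weight ℝ 𝔥 𝔤, LieAlgebra.rootSpace 𝔥 χ := by
  rw [show ⨆ χ : LieModule.Weight ℝ 𝔥 𝔤, LieAlgebra.rootSpace 𝔥 χ = ⊤ from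
    LieModule.iSup_genWeightSpace_eq_top' ℝ 𝔥 𝔤]
  exact LieSubmodule.mem_top y

theorem CartanGroup.ext_char {g h : CartanGroup 𝔥} (hgh : ∀ φ, char g φ = char h φ) : g = h := by
  refine Subtype.ext (LieEquiv.ext fun y => ?_)
  have hy := mem_iSup_rootSpace (𝔥 := 𝔥) y
  induction hy using LieSubmodule.iSup_induction' with
  | mem χ y hy =>
    by_cases hχ : χ.IsNonZero
    · have hmem : χ ∈ 𝔥.root := by simpa using hχ
      rw [char_spec g ⟨χ, hmem⟩ y hy, char_spec h ⟨χ, hmem⟩ y hy, hgh]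
    · have hχ0 : (χ : 𝔥 → ℝ) = 0 := not_not.mp hχ
      rw [hχ0] at hy
      rw [map_eq_of_mem_rootSpace_zero g hy, map_eq_of_mem_rootSpace_zero h hy]
  | zero => rw [map_zero, map_zero]
  | add x y _ _ hx hy => rw [map_add, map_add, hx, hy]

theorem embed_injective : Function.Injective (embed (𝔥 := 𝔥)) := fun _ _ hgh =>
  CartanGroup.ext_char fun φ => OnePoint.coe_injective (congrFun hgh φ)

/-- A function on the roots that respects addition and negation. -/
structure IsMultiplicative (c : 𝔥.root → ℝ) : Prop where
  ne_zero : ∀ φ, c φ ≠ 0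
  neg : ∀ φ, c (negRoot 𝔥 φ) = (c φ)⁻¹
  add : ∀ φ ψ θ, (rootSys 𝔥).root θ = (rootSys 𝔥).root φ + (rootSys 𝔥).root ψ → c θ = c φ * c ψ

theorem isMultiplicative_char (h : CartanGroup 𝔥) : IsMultiplicative (char h) :=
  ⟨char_ne_zero h, char_negRoot h, fun _ _ _ hθ => char_add hθ h⟩

theorem IsMultiplicative.weylRoot {c : 𝔥.root → ℝ} (hc : IsMultiplicative c) (w : Weyl 𝔥) :
    IsMultiplicative fun φ => c (weylRoot 𝔥 w φ) :=
  ⟨fun _ => hc.ne_zero _, fun φ => by rw [weylRoot_negRoot, hc.neg],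
    fun _ _ _ hθ => hc.add _ _ _ (weylRoot_add hθ w)⟩

theorem isMultiplicative_exp (x : 𝔥) :
    IsMultiplicative fun φ : 𝔥.root => Real.exp (φ.1 x) :=
  ⟨fun _ => Real.exp_ne_zero _, fun φ => by rw [coe_negRoot, Pi.neg_apply, Real.exp_neg],
    fun _ _ _ hθ => by rw [coe_eq_add hθ, Pi.add_apply, Real.exp_add]⟩

theorem prod_zpow_simpleCoeff_simple (b : (rootSys 𝔥).Base) (u : b.support → ℝ) (i : b.support) :
    ∏ j, u j ^ simpleCoeff b i j = u i := by
  classical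
  rw [Finset.prod_eq_single i]
  · rw [simpleCoeff_simple, if_pos rfl, zpow_one]
  · intro j _ hj
    rw [simpleCoeff_simple, if_neg hj, zpow_zero]
  · exact fun h => absurd (Finset.mem_univ i) h

/-- Every positive root is reached from a simple one by adding simple roots while staying inside the
root system; negation gives the others. -/
theorem IsMultiplicative.eq_prod (b : (rootSys 𝔥).Base) {c : 𝔥.root → ℝ}
    (hc : IsMultiplicative c) (φ : 𝔥.root) :
    c φ = ∏ j : b.support, c j ^ simpleCoeff b φ j := by
  classical
  induction φ using b.induction_add with
  | h₀ φ ih =>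
    change c (negRoot 𝔥 φ) = ∏ j : b.support, c j ^ simpleCoeff b (negRoot 𝔥 φ) j
    simp only [hc.neg, simpleCoeff_negRoot, zpow_neg, Finset.prod_inv_distrib]
    rw [ih]
  | h₁ i hi => exact (prod_zpow_simpleCoeff_simple b (fun j => c j) ⟨i, hi⟩).symm
  | h₂ φ ψ θ hθ ih hψ =>
    have hψ' : c ψ = ∏ j : b.support, c j ^ simpleCoeff b ψ j :=
      (prod_zpow_simpleCoeff_simple b (fun j => c j) ⟨ψ, hψ⟩).symm
    rw [hc.add _ _ _ hθ, ih, hψ', ← Finset.prod_mul_distrib]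
    refine Finset.prod_congr rfl fun j _ => ?_
    rw [simpleCoeff_add b hθ, zpow_add₀ (hc.ne_zero _)]

theorem isMultiplicative_prod (b : (rootSys 𝔥).Base) {u : b.support → ℝ} (hu : ∀ j, u j ≠ 0) :
    IsMultiplicative fun φ => ∏ j, u j ^ simpleCoeff b φ j where
  ne_zero φ := Finset.prod_ne_zero_iff.mpr fun j _ => zpow_ne_zero _ (hu j)
  neg φ := by simp only [simpleCoeff_negRoot, zpow_neg, Finset.prod_inv_distrib]
  add φ ψ θ hθ := by
    rw [← Finset.prod_mul_distrib]
    exact Finset.prod_congr rfl fun j _ => by rw [simpleCoeff_add b hθ, zpow_add₀ (hu j)]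

open Classical in
/-- The extension of a function on the roots to all weights by `1`. -/
def extendWeight (c : 𝔥.root → ℝ) (χ : LieModule.Weight ℝ 𝔥 𝔤) : ℝ :=
  if h : χ ∈ 𝔥.root then c ⟨χ, h⟩ else 1

theorem IsMultiplicative.extendWeight_ne_zero {c : 𝔥.root → ℝ} (hc : IsMultiplicative c)
    (χ : LieModule.Weight ℝ 𝔥 𝔤) : extendWeight c χ ≠ 0 := by
  unfold extendWeight
  split_ifs
  · exact hc.ne_zero _
  · exact one_ne_zero

theorem extendWeight_of_eq_zero (c : 𝔥.root → ℝ) {χ : LieModule.Weight ℝ 𝔥 𝔤}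
    (hχ : (χ : 𝔥 → ℝ) = 0) : extendWeight c χ = 1 :=
  dif_neg (by simpa using hχ)

/-- This is the compatibility with brackets of weight vectors. Opposite roots, whose sum is the
weight `0`, are where the rule for negation enters. -/
theorem IsMultiplicative.extendWeight_add {c : 𝔥.root → ℝ} (hc : IsMultiplicative c)
    {χ ψ θ : LieModule.Weight ℝ 𝔥 𝔤} (h : (θ : 𝔥 → ℝ) = χ + ψ) :
    extendWeight c θ = extendWeight c χ * extendWeight c ψ := by
  by_cases hχ : (χ : 𝔥 → ℝ) = 0
  · have : θ = ψ := DFunLike.coe_injective (by rw [h, hχ, zero_add])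
    rw [extendWeight_of_eq_zero c hχ, one_mul, this]
  by_cases hψ : (ψ : 𝔥 → ℝ) = 0
  · have : θ = χ := DFunLike.coe_injective (by rw [h, hψ, add_zero])
    rw [extendWeight_of_eq_zero c hψ, mul_one, this]
  have hχ' : χ ∈ 𝔥.root := by simpa using hχ
  have hψ' : ψ ∈ 𝔥.root := by simpa using hψ
  by_cases hθ : (θ : 𝔥 → ℝ) = 0
  · have : (⟨ψ, hψ'⟩ : 𝔥.root) = negRoot 𝔥 ⟨χ, hχ'⟩ :=
      Subtype.ext (DFunLike.coe_injective (by
        rw [coe_negRoot]; exact eq_neg_of_add_eq_zero_right (h.symm.trans hθ)))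
    rw [extendWeight_of_eq_zero c hθ, extendWeight, extendWeight, dif_pos hχ', dif_pos hψ', this,
      hc.neg, mul_inv_cancel₀ (hc.ne_zero _)]
  · have hθ' : θ ∈ 𝔥.root := by simpa using hθ
    rw [extendWeight, extendWeight, extendWeight, dif_pos hχ', dif_pos hψ', dif_pos hθ']
    exact hc.add _ _ _ (LinearMap.ext fun x => congrFun h x)

theorem exists_linearEquiv_weight (d : LieModule.Weight ℝ 𝔥 𝔤 → ℝ) (hd : ∀ χ, d χ ≠ 0) :
    ∃ f : 𝔤 ≃ₗ[ℝ] 𝔤, ∀ χ : LieModule.Weight ℝ 𝔥 𝔤, ∀ y ∈ LieAlgebra.rootSpace 𝔥 χ, f y = d χ • y := by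
  classical
  have hint : DirectSum.IsInternal fun χ : LieModule.Weight ℝ 𝔥 𝔤 =>
      (LieAlgebra.rootSpace 𝔥 χ).toSubmodule := by
    refine DirectSum.isInternal_submodule_of_iSupIndep_of_iSup_eq_top ?_ ?_
    · exact LieSubmodule.iSupIndep_toSubmodule.mpr (LieModule.iSupIndep_genWeightSpace' ℝ 𝔥 𝔤)
    · rw [← LieSubmodule.iSup_toSubmodule]
      exact (LieSubmodule.toSubmodule_eq_top _).mpr (LieModule.iSup_genWeightSpace_eq_top' ℝ 𝔥 𝔤)
  let E := LinearEquiv.ofBijective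
    (DirectSum.coeLinearMap fun χ : LieModule.Weight ℝ 𝔥 𝔤 =>
      (LieAlgebra.rootSpace 𝔥 χ).toSubmodule) hint
  let D := DFinsupp.mapRange.linearEquiv fun χ : LieModule.Weight ℝ 𝔥 𝔤 =>
    LinearEquiv.smulOfNeZero ℝ (LieAlgebra.rootSpace 𝔥 χ).toSubmodule (d χ) (hd χ)
  refine ⟨E.symm.trans (D.trans E), fun χ y hy => ?_⟩
  have h1 : E (DirectSum.lof ℝ _ _ χ ⟨y, hy⟩) = y :=
    DirectSum.coeLinearMap_lof (fun χ : LieModule.Weight ℝ 𝔥 𝔤 =>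
      (LieAlgebra.rootSpace 𝔥 χ).toSubmodule) χ ⟨y, hy⟩
  have h2 : E.symm y = DirectSum.lof ℝ _ _ χ ⟨y, hy⟩ := by rw [LinearEquiv.symm_apply_eq, h1]
  have h3 : D (DirectSum.lof ℝ _ _ χ ⟨y, hy⟩) = d χ • DirectSum.lof ℝ _ _ χ ⟨y, hy⟩ := by
    rw [← map_smul]
    refine DFinsupp.mapRange_single (hf := ?_)
    exact fun χ => smul_zero (d χ)
  rw [LinearEquiv.trans_apply, LinearEquiv.trans_apply, h2, h3, map_smul, h1]

/-- Every multiplicative function on the roots is given by an element of the Cartan subgroup. -/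
theorem IsMultiplicative.exists_char_eq {c : 𝔥.root → ℝ} (hc : IsMultiplicative c) :
    ∃ h : CartanGroup 𝔥, ∀ φ, char h φ = c φ := by
  obtain ⟨f, hf⟩ := exists_linearEquiv_weight (extendWeight c) hc.extendWeight_ne_zero
  -- By bilinearity it is enough to treat weight vectors; if the sum of their weights is not a
  -- weight, both sides vanish.
  have hlie : ∀ x y : 𝔤, f ⁅x, y⁆ = ⁅f x, f y⁆ := by
    intro x y
    have hx := mem_iSup_rootSpace (𝔥 := 𝔥) x
    induction hx using LieSubmodule.iSup_induction' with
    | zero => simp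
    | add x x' _ _ hx hx' => simp only [add_lie, map_add, hx, hx']
    | mem χ x hx =>
      have hy := mem_iSup_rootSpace (𝔥 := 𝔥) y
      induction hy using LieSubmodule.iSup_induction' with
      | zero => simp
      | add y y' _ _ hy hy' => simp only [lie_add, map_add, hy, hy']
      | mem ψ y hy =>
        have hxy := LieAlgebra.lie_mem_genWeightSpace_of_mem_genWeightSpace hx hy
        by_cases hbot : LieModule.genWeightSpace 𝔤 ((χ : 𝔥 → ℝ) + (ψ : 𝔥 → ℝ)) = ⊥
        · rw [hbot, LieSubmodule.mem_bot] at hxy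
          rw [hf χ x hx, hf ψ y hy, smul_lie, lie_smul, hxy]
          simp
        · let θ : LieModule.Weight ℝ 𝔥 𝔤 := ⟨(χ : 𝔥 → ℝ) + (ψ : 𝔥 → ℝ), hbot⟩
          have hθ : (θ : 𝔥 → ℝ) = χ + ψ := rfl
          rw [hf χ x hx, hf ψ y hy, hf θ _ hxy, smul_lie, lie_smul, smul_smul,
            hc.extendWeight_add hθ]
  refine ⟨⟨{ f with map_lie' := fun {x y} => hlie x y }, fun x => ?_⟩, fun φ => ?_⟩
  · change f x = x
    have hx : (x : 𝔤) ∈ LieAlgebra.rootSpace 𝔥 (0 : 𝔥 → ℝ) := by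
      rw [LieAlgebra.rootSpace_zero_eq ℝ 𝔤 𝔥]
      exact x.2
    by_cases hbot : LieModule.genWeightSpace 𝔤 (0 : 𝔥 → ℝ) = ⊥
    · have : (x : 𝔤) = 0 := by
        rw [LieAlgebra.rootSpace, hbot, LieSubmodule.mem_bot] at hx
        exact hx
      rw [this, map_zero]
    · rw [hf ⟨0, hbot⟩ x hx, extendWeight_of_eq_zero c rfl, one_smul]
  · obtain ⟨y, hy, hy0⟩ := φ.1.exists_ne_zero
    refine char_eq_of_map_eq_smul hy hy0 ((hf φ.1 y hy).trans ?_)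
    rw [extendWeight, dif_pos φ.2]

theorem isExp_iff {x : 𝔥} {h : CartanGroup 𝔥} :
    IsExp x h ↔ ∀ φ : 𝔥.root, char h φ = Real.exp (φ.1 x) := by
  refine ⟨fun H φ => ?_, fun H φ y hy => by rw [← H φ, char_spec h φ y hy]⟩
  obtain ⟨y, hy, hy0⟩ := φ.1.exists_ne_zero
  exact char_eq_of_map_eq_smul hy hy0 (H φ y hy)

theorem char_eq_prod (b : (rootSys 𝔥).Base) (h : CartanGroup 𝔥) (φ : 𝔥.root) :
    char h φ = ∏ j : b.support, char h j ^ simpleCoeff b φ j :=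
  (isMultiplicative_char h).eq_prod b φ

theorem exists_char_simple_eq (b : (rootSys 𝔥).Base) {u : b.support → ℝ} (hu : ∀ j, u j ≠ 0) :
    ∃ h : CartanGroup 𝔥, ∀ j : b.support, char h j = u j := by
  obtain ⟨h, hh⟩ := (isMultiplicative_prod b hu).exists_char_eq
  exact ⟨h, fun j => by rw [hh, prod_zpow_simpleCoeff_simple]⟩

theorem char_comp {g h k : CartanGroup 𝔥} (hgk : ∀ y : 𝔤, h.1 y = g.1 (k.1 y)) (φ : 𝔥.root) :
    char h φ = char g φ * char k φ := by
  obtain ⟨y, hy, hy0⟩ := φ.1.exists_ne_zero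
  refine char_eq_of_map_eq_smul hy hy0 ?_
  rw [hgk, char_spec k φ y hy, map_smul, char_spec g φ y hy, smul_smul, mul_comm]

end Characters

/-! ### The projective line -/

section ProjectiveLine

/-- Inversion as a map to the projective line. -/
def invPoint (x : ℝ) : OnePoint ℝ := if x = 0 then OnePoint.infty else ((x⁻¹ : ℝ) : OnePoint ℝ)

theorem invPoint_zero : invPoint 0 = OnePoint.infty := if_pos rfl

theorem invPoint_of_ne_zero {x : ℝ} (hx : x ≠ 0) : invPoint x = ((x⁻¹ : ℝ) : OnePoint ℝ) :=
  if_neg hx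

/-- Both ends of the line are glued at `∞`, so there is no jump at `0`. This lets characters of
positive roots extend across `t_i = 0`. -/
theorem continuous_invPoint : Continuous invPoint := by
  rw [continuous_iff_continuousAt]
  intro x
  by_cases hx : x = 0
  · subst hx
    rw [continuousAt_iff_punctured_nhds, invPoint_zero]
    have h1 : Filter.Tendsto (fun x : ℝ => ((x⁻¹ : ℝ) : OnePoint ℝ)) (nhdsWithin 0 {0}ᶜ)
        (nhds OnePoint.infty) := by
      refine OnePoint.tendsto_coe_infty.comp ?_
      rw [Filter.coclosedCompact_eq_cocompact, ← Metric.cobounded_eq_cocompact]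
      exact Filter.tendsto_inv₀_nhdsNE_zero
    refine h1.congr' ?_
    filter_upwards [self_mem_nhdsWithin] with y hy
    exact (invPoint_of_ne_zero hy).symm
  · have h1 : ContinuousAt (fun x : ℝ => ((x⁻¹ : ℝ) : OnePoint ℝ)) x :=
      OnePoint.continuous_coe.continuousAt.comp (continuousAt_inv₀ hx)
    refine h1.congr ?_
    filter_upwards [isOpen_ne.mem_nhds hx] with y hy
    exact (invPoint_of_ne_zero hy).symm

/-- The affine coordinate on the projective line, with the value `0` at infinity. -/
def affineCoord (x : OnePoint ℝ) : ℝ := x.elim 0 id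

@[simp] theorem affineCoord_coe (x : ℝ) : affineCoord (x : OnePoint ℝ) = x := rfl

theorem coe_affineCoord {x : OnePoint ℝ} (hx : x ≠ OnePoint.infty) :
    ((affineCoord x : ℝ) : OnePoint ℝ) = x := by
  obtain ⟨y, rfl⟩ := OnePoint.ne_infty_iff_exists.mp hx
  rfl

theorem continuousAt_affineCoord {x : OnePoint ℝ} (hx : x ≠ OnePoint.infty) :
    ContinuousAt affineCoord x := by
  obtain ⟨y, rfl⟩ := OnePoint.ne_infty_iff_exists.mp hx
  rw [OnePoint.continuousAt_coe]
  exact continuousAt_id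

end ProjectiveLine

/-! ### The affine chart of the antidominant chamber -/

section Param

variable (b : (rootSys 𝔥).Base)

/-- The monomial in the coordinates `χ_{-α_i}` that gives the character of the negative one of
`φ` and `-φ`. -/
def monomial (t : b.support → ℝ) (φ : 𝔥.root) : ℝ :=
  ∏ j, t j ^ (simpleCoeff b φ j).natAbs

open Classical in
/-- The point with the coordinates `χ_{-α_i} = t_i`. -/
def param (t : b.support → ℝ) : Ambient 𝔥 := fun φ =>
  if b.IsPos φ then invPoint (monomial b t φ) else ((monomial b t φ : ℝ) : OnePoint ℝ)

theorem param_of_pos {φ : 𝔥.root} (hφ : b.IsPos φ) (t : b.support → ℝ) :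
    param b t φ = invPoint (monomial b t φ) := if_pos hφ

theorem param_of_not_pos {φ : 𝔥.root} (hφ : ¬ b.IsPos φ) (t : b.support → ℝ) :
    param b t φ = ((monomial b t φ : ℝ) : OnePoint ℝ) := if_neg hφ

theorem contDiff_monomial (φ : 𝔥.root) : ContDiff ℝ ∞ fun t => monomial b t φ :=
  contDiff_prod fun j _ => (contDiff_apply ℝ ℝ j).pow _

theorem continuous_param : Continuous (param b) := by
  refine continuous_pi fun φ => ?_
  have h := (contDiff_monomial b φ).continuous
  by_cases hφ : b.IsPos φ
  · simp only [param_of_pos b hφ]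
    exact continuous_invPoint.comp h
  · simp only [param_of_not_pos b hφ]
    exact OnePoint.continuous_coe.comp h

/-- For a positive root, finiteness of the coordinate says that the monomial to be inverted does not
vanish. Smoothness of all transition maps comes down to this. -/
theorem contDiffAt_affineCoord_param {φ : 𝔥.root} {t : b.support → ℝ}
    (ht : param b t φ ≠ OnePoint.infty) :
    ContDiffAt ℝ ∞ (fun t => affineCoord (param b t φ)) t := by
  have h := (contDiff_monomial b φ).contDiffAt (x := t)
  by_cases hφ : b.IsPos φ
  · rw [param_of_pos b hφ] at ht
    have h0 : monomial b t φ ≠ 0 := fun h0 => ht (by rw [h0, invPoint_zero])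
    refine (h.inv h0).congr_of_eventuallyEq ?_
    filter_upwards [(contDiff_monomial b φ).continuous.continuousAt.eventually_ne h0] with s hs
    rw [param_of_pos b hφ, invPoint_of_ne_zero hs, affineCoord_coe]
    rfl
  · simpa only [param_of_not_pos b hφ, affineCoord_coe] using h

theorem param_negRoot (t : b.support → ℝ) (i : b.support) :
    param b t (negRoot 𝔥 i) = ((t i : ℝ) : OnePoint ℝ) := by
  classical
  rw [param_of_not_pos b (not_isPos_negRoot b i), monomial, Finset.prod_eq_single i]
  · rw [simpleCoeff_negRoot, simpleCoeff_simple, if_pos rfl]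
    simp
  · intro j _ hj
    rw [simpleCoeff_negRoot, simpleCoeff_simple, if_neg hj]
    simp
  · exact fun h => absurd (Finset.mem_univ i) h

theorem param_injective : Function.Injective (param b) := fun s t hst => funext fun i => by
  have h := congrFun hst (negRoot 𝔥 i)
  rw [param_negRoot, param_negRoot] at h
  exact OnePoint.coe_injective h

theorem monomial_of_pos {φ : 𝔥.root} (hφ : b.IsPos φ) (t : b.support → ℝ) :
    monomial b t φ = ∏ j, t j ^ simpleCoeff b φ j :=
  Finset.prod_congr rfl fun j _ => by
    rw [← zpow_natCast, Int.natAbs_of_nonneg (simpleCoeff_nonneg b hφ j)]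

theorem monomial_of_not_pos {φ : 𝔥.root} (hφ : ¬ b.IsPos φ) (t : b.support → ℝ) :
    monomial b t φ = (∏ j, t j ^ simpleCoeff b φ j)⁻¹ := by
  rw [← Finset.prod_inv_distrib]
  exact Finset.prod_congr rfl fun j _ => by
    rw [← zpow_natCast, Int.ofNat_natAbs_of_nonpos (simpleCoeff_nonpos b hφ j), zpow_neg]

theorem monomial_ne_zero_iff {φ : 𝔥.root} {t : b.support → ℝ} :
    monomial b t φ ≠ 0 ↔ ∀ j, t j = 0 → simpleCoeff b φ j = 0 := by
  rw [monomial, Finset.prod_ne_zero_iff]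
  refine ⟨fun H j hj => ?_, fun H j _ hj => ?_⟩
  · by_contra hne
    exact H j (Finset.mem_univ j) (by rw [hj, zero_pow (Int.natAbs_ne_zero.mpr hne)])
  · have h0 := H j (eq_zero_of_pow_eq_zero hj)
    rw [h0] at hj
    simp at hj

/-- Vanishing coordinates enter with exponent `0`, so `h` need only match `t` where `t` is nonzero.
This serves both `H_ℝ` and the added strata. -/
theorem param_eq_char {t : b.support → ℝ} {h : CartanGroup 𝔥} {φ : 𝔥.root}
    (hφ : ∀ j, t j = 0 → simpleCoeff b φ j = 0)
    (hh : ∀ j, t j ≠ 0 → char h j = (t j)⁻¹) :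
    param b t φ = ((char h φ : ℝ) : OnePoint ℝ) := by
  have hprod : ∏ j : b.support, char h j ^ simpleCoeff b φ j =
      (∏ j : b.support, t j ^ simpleCoeff b φ j)⁻¹ := by
    rw [← Finset.prod_inv_distrib]
    refine Finset.prod_congr rfl fun j _ => ?_
    by_cases hj : t j = 0
    · rw [hφ j hj, zpow_zero, zpow_zero, inv_one]
    · rw [hh j hj, inv_zpow]
  rw [char_eq_prod b h φ, hprod]
  by_cases hpos : b.IsPos φ
  · rw [param_of_pos b hpos, invPoint_of_ne_zero ((monomial_ne_zero_iff b).mpr hφ),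
      monomial_of_pos b hpos]
  · rw [param_of_not_pos b hpos, monomial_of_not_pos b hpos]

theorem embed_eq_param (h : CartanGroup 𝔥) :
    embed h = param b fun i => char h (negRoot 𝔥 i) :=
  funext fun _ => (param_eq_char b
    (fun _ hj => absurd hj (char_ne_zero h _))
    (fun _ _ => by rw [char_negRoot, inv_inv])).symm

theorem exists_char_negRoot_eq {t : b.support → ℝ} (ht : ∀ i, t i ≠ 0) :
    ∃ h : CartanGroup 𝔥, (fun i : b.support => char h (negRoot 𝔥 i)) = t := by
  obtain ⟨h, hh⟩ := exists_char_simple_eq b (u := fun j => (t j)⁻¹) fun j => inv_ne_zero (ht j)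
  exact ⟨h, funext fun i => by rw [char_negRoot, hh, inv_inv]⟩

/-- Points with all coordinates nonzero are dense in `ℝ^l` and come from `H_ℝ`. -/
theorem param_mem_closure (t : b.support → ℝ) :
    param b t ∈ closure (range (embed (𝔥 := 𝔥))) := by
  have hd : Dense (univ.pi fun _ : b.support => ({0}ᶜ : Set ℝ)) :=
    dense_pi univ fun _ _ => dense_compl_singleton 0
  refine closure_mono ?_ (image_closure_subset_closure_image (continuous_param b)
    ⟨t, hd t, rfl⟩)
  rintro _ ⟨s, hs, rfl⟩
  obtain ⟨h, rfl⟩ := exists_char_negRoot_eq b (t := s) fun i => hs i (mem_univ i)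
  exact ⟨h, embed_eq_param b h⟩

/-- The identity holds on the image of `H_ℝ`, and its left side is continuous at `p` because the
coordinates used are finite there; limits in a Hausdorff space are unique. -/
theorem param_affineCoord {p : Ambient 𝔥} (hp : p ∈ closure (range (embed (𝔥 := 𝔥))))
    (hfin : ∀ i : b.support, p (negRoot 𝔥 i) ≠ OnePoint.infty) :
    param b (fun i => affineCoord (p (negRoot 𝔥 i))) = p := by
  rw [mem_closure_iff_clusterPt] at hp
  have hne : (nhds p ⊓ Filter.principal (range (embed (𝔥 := 𝔥)))).NeBot := hp
  have h1 : ContinuousAt (fun p : Ambient 𝔥 =>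
      param b (fun i => affineCoord (p (negRoot 𝔥 i)))) p := by
    refine (continuous_param b).continuousAt.comp (continuousAt_pi.mpr fun i => ?_)
    exact ContinuousAt.comp (f := fun p : Ambient 𝔥 => p (negRoot 𝔥 i))
      (continuousAt_affineCoord (hfin i)) (continuous_apply _).continuousAt
  have h2 := h1.tendsto.mono_left
    (inf_le_left : nhds p ⊓ Filter.principal (range (embed (𝔥 := 𝔥))) ≤ nhds p)
  have h3 : Filter.Tendsto id (nhds p ⊓ Filter.principal (range (embed (𝔥 := 𝔥)))) (nhds p) :=
    Filter.tendsto_id.mono_left inf_le_left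
  refine tendsto_nhds_unique (h2.congr' ?_) h3
  filter_upwards [Filter.mem_inf_of_right (Filter.mem_principal_self _)]
  rintro _ ⟨h, rfl⟩
  exact (embed_eq_param b h).symm

end Param

/-! ### The closed chambers -/

section ClosedChamber

variable (b : (rootSys 𝔥).Base)

/-- The image of the closed chamber under the coordinates `χ_{-α_i}`. -/
def box (ε : Signs b) : Set (b.support → ℝ) :=
  {t | ∀ i, 0 ≤ ((ε i : ℤ) : ℝ) * t i ∧ ((ε i : ℤ) : ℝ) * t i ≤ 1}

/-- The image of the open chamber under the coordinates `χ_{-α_i}`. -/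
def openBox (ε : Signs b) : Set (b.support → ℝ) :=
  {t | ∀ i, 0 < ((ε i : ℤ) : ℝ) * t i ∧ ((ε i : ℤ) : ℝ) * t i ≤ 1}

theorem closure_halfOpen (e : ℤˣ) :
    closure {x : ℝ | 0 < ((e : ℤ) : ℝ) * x ∧ ((e : ℤ) : ℝ) * x ≤ 1} =
      {x : ℝ | 0 ≤ ((e : ℤ) : ℝ) * x ∧ ((e : ℤ) : ℝ) * x ≤ 1} := by
  rcases Int.units_eq_one_or e with rfl | rfl
  · have h1 : {x : ℝ | 0 < (((1 : ℤˣ) : ℤ) : ℝ) * x ∧ (((1 : ℤˣ) : ℤ) : ℝ) * x ≤ 1} = Ioc 0 1 := by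
      ext x; simp
    rw [h1, closure_Ioc zero_ne_one]
    ext x; simp
  · have h1 : {x : ℝ | 0 < (((-1 : ℤˣ) : ℤ) : ℝ) * x ∧ (((-1 : ℤˣ) : ℤ) : ℝ) * x ≤ 1} =
        Ico (-1) 0 := by
      ext x
      simp only [Units.val_neg, Units.val_one, Int.cast_neg, Int.cast_one, mem_ofPred_eq, mem_Ico]
      constructor <;> rintro ⟨h1, h2⟩ <;> constructor <;> linarith
    rw [h1, closure_Ico (by norm_num)]
    ext x
    simp only [Units.val_neg, Units.val_one, Int.cast_neg, Int.cast_one, mem_ofPred_eq, mem_Icc]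
    constructor <;> rintro ⟨h1, h2⟩ <;> constructor <;> linarith

theorem closure_openBox (ε : Signs b) : closure (openBox b ε) = box b ε := by
  have h1 : openBox b ε = univ.pi fun i =>
      {x : ℝ | 0 < ((ε i : ℤ) : ℝ) * x ∧ ((ε i : ℤ) : ℝ) * x ≤ 1} := by
    ext t; simp [openBox]
  have h2 : box b ε = univ.pi fun i =>
      {x : ℝ | 0 ≤ ((ε i : ℤ) : ℝ) * x ∧ ((ε i : ℤ) : ℝ) * x ≤ 1} := by
    ext t; simp [box]
  rw [h1, h2, closure_pi_set]
  simp only [closure_halfOpen]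

/-- The affine identification of `[-1, 1]^l` with the box of `ε`. -/
def boxHomeo (ε : Signs b) : (b.support → ℝ) ≃ₜ (b.support → ℝ) where
  toFun t i := 2 * ((ε i : ℤ) : ℝ) * t i - 1
  invFun s i := ((ε i : ℤ) : ℝ) * ((s i + 1) / 2)
  left_inv t := funext fun i => by
    rcases Int.units_eq_one_or (ε i) with h | h <;> simp [h] <;> ring
  right_inv s := funext fun i => by
    rcases Int.units_eq_one_or (ε i) with h | h <;> simp [h] <;> ring
  continuous_toFun := by fun_prop
  continuous_invFun := by fun_prop

theorem boxHomeo_image (ε : Signs b) : boxHomeo b ε '' box b ε = Icc (-1) 1 := by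
  rw [Homeomorph.image_eq_preimage_symm]
  ext s
  have key : ∀ i, ((ε i : ℤ) : ℝ) * (((ε i : ℤ) : ℝ) * ((s i + 1) / 2)) = (s i + 1) / 2 :=
    fun i => by rcases Int.units_eq_one_or (ε i) with h | h <;> simp [h]
  change (∀ i, 0 ≤ ((ε i : ℤ) : ℝ) * (((ε i : ℤ) : ℝ) * ((s i + 1) / 2)) ∧
    ((ε i : ℤ) : ℝ) * (((ε i : ℤ) : ℝ) * ((s i + 1) / 2)) ≤ 1) ↔ _
  simp only [key, mem_Icc, Pi.le_def, Pi.neg_apply, Pi.one_apply, ← forall_and]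
  refine forall_congr' fun i => ?_
  constructor <;> rintro ⟨h1, h2⟩ <;> constructor <;> linarith

theorem isCompact_box (ε : Signs b) : IsCompact (box b ε) := by
  have h : box b ε = (boxHomeo b ε).symm '' Icc (-1) 1 := by
    rw [← boxHomeo_image b ε, ← image_comp, Homeomorph.symm_comp_self, image_id]
  rw [h]
  exact isCompact_Icc.image (boxHomeo b ε).symm.continuous

theorem abs_le_one_and_sign_inv_iff {x : ℝ} (hx0 : x ≠ 0) (e : ℤˣ) :
    |x| ≤ 1 ∧ Real.sign x⁻¹ = ((e : ℤ) : ℝ) ↔ 0 < ((e : ℤ) : ℝ) * x ∧ ((e : ℤ) : ℝ) * x ≤ 1 := by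
  rw [Real.sign_inv]
  rcases lt_or_gt_of_ne hx0 with hx | hx <;> rcases Int.units_eq_one_or e with h | h
  · simp only [h, Real.sign_of_neg hx, Units.val_one, Int.cast_one, one_mul, hx.not_gt, false_and,
      iff_false]
    norm_num
  · simp [h, Real.sign_of_neg hx, hx, abs_of_neg hx]
  · simp [h, Real.sign_of_pos hx, hx, abs_of_pos hx]
  · simp only [h, Real.sign_of_pos hx, Units.val_neg, Units.val_one, Int.cast_neg, Int.cast_one,
      neg_mul, one_mul, Left.neg_pos_iff, hx.not_gt, false_and, iff_false]
    norm_num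

theorem mem_chamber_iff {ε : Signs b} {h : CartanGroup 𝔥} :
    h ∈ chamber b ε ↔ (fun i : b.support => char h (negRoot 𝔥 i)) ∈ openBox b ε := by
  refine forall_congr' fun i => ?_
  have hinv : char h i = (char h (negRoot 𝔥 i))⁻¹ := by rw [char_negRoot, inv_inv]
  rw [hinv]
  exact abs_le_one_and_sign_inv_iff (char_ne_zero h _) (ε i)

theorem embed_image_chamber (ε : Signs b) :
    embed '' chamber b ε = param b '' openBox b ε := by
  ext p
  constructor
  · rintro ⟨h, hh, rfl⟩
    exact ⟨_, (mem_chamber_iff b).mp hh, (embed_eq_param b h).symm⟩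
  · rintro ⟨t, ht, rfl⟩
    obtain ⟨h, rfl⟩ := exists_char_negRoot_eq b (t := t) fun i h0 => by
      have := (ht i).1
      rw [h0, mul_zero] at this
      exact lt_irrefl _ this
    exact ⟨h, (mem_chamber_iff b).mpr ht, embed_eq_param b h⟩

theorem closedChamber_eq (ε : Signs b) : closedChamber b ε = param b '' box b ε := by
  rw [closedChamber, embed_image_chamber, ← closure_openBox,
    image_closure_of_isCompact (closure_openBox b ε ▸ isCompact_box b ε)
      (continuous_param b).continuousOn]

/-- The closed chamber is homeomorphic to its box of coordinates. -/
def boxHomeoClosedChamber (ε : Signs b) : box b ε ≃ₜ closedChamber b ε :=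
  haveI : CompactSpace (box b ε) := isCompact_iff_compactSpace.mp (isCompact_box b ε)
  Continuous.homeoOfEquivCompactToT2
    (f := ((Equiv.Set.image (param b) (box b ε) (param_injective b)).trans
      (Equiv.setCongr (closedChamber_eq b ε).symm)))
    (((continuous_param b).comp continuous_subtype_val).subtype_mk _)

theorem nonempty_closedChamber_homeo (ε : Signs b) :
    Nonempty (closedChamber b ε ≃ₜ Icc (-1 : b.support → ℝ) 1) :=
  ⟨(boxHomeoClosedChamber b ε).symm.trans
    (((boxHomeo b ε).image (box b ε)).trans (Homeomorph.setCongr (boxHomeo_image b ε)))⟩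

end ClosedChamber

/-! ### The pieces of the subsystems -/

section SubChamber

variable (b : (rootSys 𝔥).Base)

/-- The form is `∑ φ(x)²` over the roots, a sum of real squares, and no nonzero `x` is killed by all
roots. -/
theorem eq_zero_of_traceForm_self {x : 𝔥} (hx : LieModule.traceForm ℝ 𝔥 𝔤 x x = 0) : x = 0 := by
  have hsum : ∑ φ : 𝔥.root, φ.1 x * φ.1 x = 0 := by
    rw [← LieAlgebra.restrict_killingForm ℝ 𝔤 𝔥,
      ← LieAlgebra.IsKilling.corootForm_rootSystem_eq_killing,
      RootPairing.corootForm_apply_apply] at hx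
    exact hx
  have hroot : ∀ φ : 𝔥.root, φ.1 x = 0 := fun φ =>
    mul_self_eq_zero.mp ((Finset.sum_eq_zero_iff_of_nonneg fun φ _ => mul_self_nonneg _).mp hsum φ
      (Finset.mem_univ φ))
  have hmem : x ∈ ⨅ χ : LieModule.Weight ℝ 𝔥 𝔤, χ.ker := by
    rw [Submodule.mem_iInf]
    intro χ
    change χ x = 0
    by_cases hχ : χ.IsNonZero
    · exact hroot ⟨χ, by simpa using hχ⟩
    · exact congrFun (not_not.mp hχ) x
  rw [LieAlgebra.IsKilling.iInf_ker_weight_eq_bot] at hmem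
  exact (Submodule.mem_bot ℝ).mp hmem

/-- The Cartan matrix of a subsystem is nondegenerate. -/
theorem exists_mem_subAlgebra (A : Set b.support) (u : b.support → ℝ) :
    ∃ x ∈ subAlgebra b A, ∀ i : b.support, i ∉ A → i.1.1 x = u i := by
  classical
  let J := {i : b.support // i ∉ A}
  let S : (J → ℝ) →ₗ[ℝ] 𝔥 := Fintype.linearCombination ℝ fun j : J => (rootSys 𝔥).coroot j.1
  let T : (J → ℝ) →ₗ[ℝ] (J → ℝ) := LinearMap.pi fun i : J => i.1.1.1.toLinear ∘ₗ S
  have hT : ∀ c i, T c i = i.1.1.1 (S c) := fun _ _ => rfl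
  have hS : ∀ c, S c = ∑ j, c j • (rootSys 𝔥).coroot j.1 := fun c =>
    Fintype.linearCombination_apply ℝ _ c
  have hmem : ∀ c, S c ∈ subAlgebra b A := fun c => by
    rw [hS]
    exact Submodule.sum_mem _ fun j _ => Submodule.smul_mem _ _
      (Submodule.subset_span ⟨j.1, j.2, rfl⟩)
  have hinj : Function.Injective T := by
    rw [← LinearMap.ker_eq_bot, LinearMap.ker_eq_bot']
    intro c hc
    -- Pairing with the coroot of `α_j` is a multiple of `α_j`, so `S c`, a combination of coroots
    -- whose roots kill it, is orthogonal to itself.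
    have h0 : S c = 0 := by
      refine eq_zero_of_traceForm_self ?_
      nth_rewrite 1 [hS]
      rw [map_sum, LinearMap.sum_apply]
      refine Finset.sum_eq_zero fun j _ => ?_
      have hj : j.1.1.1 (S c) = 0 := by rw [← hT, hc]; rfl
      rw [map_smul, LinearMap.smul_apply, LieAlgebra.IsKilling.rootSystem_coroot_apply,
        LieAlgebra.IsKilling.traceForm_coroot, hj]
      simp
    have hli : LinearIndependent ℝ fun j : J => (rootSys 𝔥).coroot j.1 :=
      LinearIndependent.comp b.linearIndepOn_coroot (fun j : J => j.1) Subtype.val_injective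
    rw [hS] at h0
    exact funext (Fintype.linearIndependent_iff.mp hli c h0)
  obtain ⟨c, hc⟩ := (LinearMap.injective_iff_surjective.mp hinj) fun i => u i.1
  exact ⟨S c, hmem c, fun i hi => congrFun hc ⟨i, hi⟩⟩

-- The monomial of `φ` vanishes exactly when a simple root of `A` occurs in `φ`, which produces the
-- prescribed values `∞` and `0`.
open Classical in
theorem subEmbed_eq_param {A : Set b.support} {h : CartanGroup 𝔥} :
    subEmbed b A h = param b fun i => if i ∈ A then 0 else char h (negRoot 𝔥 i) := by
  funext φ
  have h0 : ∀ j : b.support, (if j ∈ A then 0 else char h (negRoot 𝔥 j)) = 0 ↔ j ∈ A := fun j => by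
    by_cases hj : j ∈ A <;> simp [hj, char_ne_zero]
  by_cases hφ : ∀ j ∈ A, simpleCoeff b φ j = 0
  · rw [subEmbed, if_pos hφ]
    refine (param_eq_char b (fun j hj => hφ j ((h0 j).mp hj)) fun j hj => ?_).symm
    rw [if_neg fun hjA => hj ((h0 j).mpr hjA), char_negRoot, inv_inv]
  · rw [subEmbed, if_neg hφ]
    have hm : monomial b (fun i => if i ∈ A then 0 else char h (negRoot 𝔥 i)) φ = 0 := by
      by_contra hne
      exact hφ fun j hj => (monomial_ne_zero_iff b).mp hne j ((h0 j).mpr hj)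
    by_cases hpos : b.IsPos φ
    · rw [if_pos hpos, param_of_pos b hpos, hm, invPoint_zero]
    · rw [if_neg hpos, param_of_not_pos b hpos, hm]

theorem signs_mul_self (e : ℤˣ) : ((e : ℤ) : ℝ) * ((e : ℤ) : ℝ) = 1 := by
  rcases Int.units_eq_one_or e with h | h <;> simp [h]

theorem signs_mul_eq_abs {e : ℤˣ} {x : ℝ} (hx : 0 ≤ ((e : ℤ) : ℝ) * x) :
    ((e : ℤ) : ℝ) * x = |x| := by
  rcases Int.units_eq_one_or e with rfl | rfl
  · simp only [Units.val_one, Int.cast_one, one_mul] at hx ⊢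
    exact (abs_of_nonneg hx).symm
  · simp only [Units.val_neg, Units.val_one, Int.cast_neg, Int.cast_one, neg_mul, one_mul,
      Left.nonneg_neg_iff] at hx ⊢
    exact (abs_of_nonpos hx).symm

theorem subEmbed_image_subset (A : Set b.support) (ε : Signs b) :
    subEmbed b A '' subChamber b A ε ⊆ closedChamber b ε := by
  classical
  rintro _ ⟨h, ⟨⟨g, k, hg, ⟨x, -, hk⟩, hgk⟩, hle⟩, rfl⟩
  rw [closedChamber_eq, subEmbed_eq_param]
  refine ⟨_, fun i => ?_, rfl⟩
  by_cases hi : i ∈ A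
  · simp [hi]
  · have hpos : 0 ≤ ((ε i : ℤ) : ℝ) * char h (negRoot 𝔥 i) := by
      have hinv : (((ε i : ℤ) : ℝ))⁻¹ = ((ε i : ℤ) : ℝ) :=
        inv_eq_of_mul_eq_one_left (signs_mul_self _)
      rw [char_negRoot, char_comp hgk, hg, if_neg hi, isExp_iff.mp hk, mul_inv, ← mul_assoc, hinv,
        signs_mul_self, one_mul]
      positivity
    simp only [if_neg hi]
    exact ⟨hpos, signs_mul_eq_abs hpos ▸ hle i hi⟩

theorem closedChamber_subset_iUnion (ε : Signs b) :
    closedChamber b ε ⊆ ⋃ A : Set b.support, subEmbed b A '' subChamber b A ε := by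
  classical
  rw [closedChamber_eq]
  rintro _ ⟨t, ht, rfl⟩
  -- The stratum of a point is read off from its vanishing coordinates.
  let A : Set b.support := {i | t i = 0}
  have hε : ∀ i, ((ε i : ℤ) : ℝ) ≠ 0 := fun i h0 => by
    have := signs_mul_self (ε i)
    rw [h0, zero_mul] at this
    exact zero_ne_one this
  obtain ⟨g, hg⟩ := exists_char_simple_eq b
    (u := fun i => if i ∈ A then 1 else ((ε i : ℤ) : ℝ)) fun i => by
      split_ifs
      · exact one_ne_zero
      · exact hε i
  -- `Real.log` sees only `|t i|`: the exponential supplies the absolute values and `g` the signs.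
  -- The minus sign is there because `t i` is the character of `-α_i`.
  obtain ⟨x, hxA, hx⟩ := exists_mem_subAlgebra b A fun i => -Real.log (t i)
  obtain ⟨k, hk⟩ := (isMultiplicative_exp x).exists_char_eq
  let h : CartanGroup 𝔥 := ⟨k.1.trans g.1, fun y => by
    rw [LieEquiv.trans_apply, k.2 y, g.2 y]⟩
  have hgk : ∀ y : 𝔤, h.1 y = g.1 (k.1 y) := fun y => LieEquiv.trans_apply _ _ y
  have hchar : ∀ i : b.support, i ∉ A → char h (negRoot 𝔥 i) = t i := fun i hi => by
    have hti : t i ≠ 0 := hi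
    rw [char_negRoot, char_comp hgk, hg, if_neg hi, hk, hx i hi, Real.exp_neg, Real.exp_log_eq_abs hti,
      ← signs_mul_eq_abs (ht i).1, mul_inv, inv_inv, ← mul_assoc,
      inv_mul_cancel₀ (hε i), one_mul]
  refine mem_iUnion.mpr ⟨A, h, ⟨⟨g, k, hg, ⟨x, hxA, isExp_iff.mpr hk⟩, hgk⟩, fun i hi => ?_⟩, ?_⟩
  · rw [hchar i hi, ← signs_mul_eq_abs (ht i).1]
    exact (ht i).2
  · rw [subEmbed_eq_param]
    congr 1
    funext i
    by_cases hi : i ∈ A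
    · rw [if_pos hi]
      exact hi.symm
    · rw [if_neg hi, hchar i hi]

theorem closedChamber_eq_iUnion (ε : Signs b) :
    closedChamber b ε = ⋃ A : Set b.support, subEmbed b A '' subChamber b A ε :=
  (closedChamber_subset_iUnion b ε).antisymm
    (iUnion_subset fun A => subEmbed_image_subset b A ε)

end SubChamber

/-! ### The compactification -/

section Compactification

theorem continuous_weylAct (w : Weyl 𝔥) : Continuous (weylAct w) :=
  continuous_pi fun _ => continuous_apply _

theorem weylAct_one (p : Ambient 𝔥) : weylAct 1 p = p :=
  funext fun φ => by rw [weylAct, inv_one, weylRoot_one]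

theorem weylAct_mul (v w : Weyl 𝔥) (p : Ambient 𝔥) :
    weylAct (v * w) p = weylAct v (weylAct w p) :=
  funext fun φ => by simp only [weylAct, mul_inv_rev, weylRoot_mul]

theorem weylAct_weylAct_inv (w : Weyl 𝔥) (p : Ambient 𝔥) : weylAct w (weylAct w⁻¹ p) = p := by
  rw [← weylAct_mul, mul_inv_cancel, weylAct_one]

theorem exists_char_weylRoot (w : Weyl 𝔥) (h : CartanGroup 𝔥) :
    ∃ g : CartanGroup 𝔥, ∀ φ, char g φ = char h (weylRoot 𝔥 w φ) :=
  ((isMultiplicative_char h).weylRoot w).exists_char_eq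

theorem weylAct_embed_mem (w : Weyl 𝔥) (h : CartanGroup 𝔥) :
    weylAct w (embed h) ∈ range (embed (𝔥 := 𝔥)) := by
  obtain ⟨g, hg⟩ := exists_char_weylRoot w⁻¹ h
  exact ⟨g, funext fun φ => by rw [weylAct, embed, embed, hg]⟩

theorem weylAct_image_range_embed (w : Weyl 𝔥) :
    weylAct w '' range (embed (𝔥 := 𝔥)) = range embed := by
  refine Subset.antisymm ?_ fun p hp => ?_
  · rintro _ ⟨_, ⟨h, rfl⟩, rfl⟩
    exact weylAct_embed_mem w h
  · obtain ⟨h, rfl⟩ := hp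
    exact ⟨_, weylAct_embed_mem w⁻¹ h, weylAct_weylAct_inv w _⟩

theorem weylAct_mem_closure (w : Weyl 𝔥) {p : Ambient 𝔥}
    (hp : p ∈ closure (range (embed (𝔥 := 𝔥)))) :
    weylAct w p ∈ closure (range (embed (𝔥 := 𝔥))) := by
  rw [← weylAct_image_range_embed w]
  exact image_closure_subset_closure_image (continuous_weylAct w) ⟨p, hp, rfl⟩

variable (b : (rootSys 𝔥).Base)

theorem isCompact_Hhat : IsCompact (Hhat b) :=
  isCompact_iUnion fun ε => isCompact_iUnion fun w =>
    IsCompact.image (closedChamber_eq b (ε.translate w) ▸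
      (isCompact_box b _).image (continuous_param b)) (continuous_weylAct w)

/-- The sign of a nonzero real number as a unit of `ℤ`. -/
def unitSign (x : ℝ) : ℤˣ := if 0 < x then 1 else -1

theorem unitSign_eq_sign {x : ℝ} (hx : x ≠ 0) : ((unitSign x : ℤ) : ℝ) = Real.sign x := by
  unfold unitSign
  rcases lt_or_gt_of_ne hx with h | h
  · rw [if_neg h.not_gt, Real.sign_of_neg h]; simp
  · rw [if_pos h, Real.sign_of_pos h]; simp

theorem unitSign_one : unitSign 1 = 1 := if_pos one_pos

theorem unitSign_mul {x y : ℝ} (hx : x ≠ 0) (hy : y ≠ 0) :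
    unitSign (x * y) = unitSign x * unitSign y := by
  unfold unitSign
  rcases lt_or_gt_of_ne hx with h | h <;> rcases lt_or_gt_of_ne hy with h' | h'
  · simp [mul_pos_of_neg_of_neg h h', h.not_gt, h'.not_gt]
  · simp [(mul_neg_of_neg_of_pos h h').not_gt, h.not_gt, h']
  · simp [(mul_neg_of_pos_of_neg h h').not_gt, h, h'.not_gt]
  · simp [mul_pos h h', h, h']

/-- The sign as a homomorphism on the units of `ℝ`. -/
def unitSignHom : ℝˣ →* ℤˣ where
  toFun x := unitSign x
  map_one' := unitSign_one
  map_mul' x y := unitSign_mul x.ne_zero y.ne_zero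

theorem unitSign_prod_zpow {ι : Type*} [Fintype ι] {u : ι → ℝ} (hu : ∀ j, u j ≠ 0) (n : ι → ℤ) :
    unitSign (∏ j, u j ^ n j) = ∏ j, unitSign (u j) ^ n j := by
  calc unitSign (∏ j, u j ^ n j)
      = unitSignHom (∏ j, Units.mk0 (u j) (hu j) ^ n j) :=
        congrArg unitSign (by simp [Units.coe_prod])
    _ = ∏ j, unitSignHom (Units.mk0 (u j) (hu j)) ^ n j := by simp only [map_prod, map_zpow]

theorem embed_mem_Hhat (h : CartanGroup 𝔥) : embed h ∈ Hhat b := by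
  -- Dominance of `log |χ|` means `|χ_{w α_i}(h)| ≥ 1`, so `g = w⁻¹ h` is antidominant; its signs
  -- are `ε(w)` for the signs `ε` of `h`.
  obtain ⟨w, hw⟩ := exists_weyl_dominant b fun j => Real.log |char h j|
  obtain ⟨g, hg⟩ := exists_char_weylRoot w h
  let ε : Signs b := fun i => unitSign (char h i)
  have hlog : ∀ φ, Real.log |char h φ| = ∑ j : b.support, (simpleCoeff b φ j : ℝ) * Real.log |char h j| :=
    fun φ => by
      rw [char_eq_prod b h φ, Finset.abs_prod, Real.log_prod]
      · simp only [abs_zpow, Real.log_zpow]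
      · exact fun j _ => abs_ne_zero.mpr (zpow_ne_zero _ (char_ne_zero h j))
  have hmem : g ∈ chamber b (ε.translate w) := fun i => by
    constructor
    · rw [char_negRoot, hg, abs_inv]
      refine inv_le_one_of_one_le₀ ?_
      have h1 := hw i
      rw [← hlog] at h1
      by_contra hlt
      exact absurd (Real.log_neg (abs_pos.mpr (char_ne_zero h _)) (not_le.mp hlt)) h1.not_gt
    · rw [hg, ← unitSign_eq_sign (char_ne_zero h _), char_eq_prod b h,
        unitSign_prod_zpow fun j => char_ne_zero h _]
      rfl
  have hemb : embed h = weylAct w (embed g) := funext fun φ => by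
    rw [weylAct, embed, embed, hg, weylRoot_weylRoot_inv]
  rw [hemb]
  exact mem_iUnion₂.mpr ⟨ε, w, mem_image_of_mem _ (subset_closure ⟨g, hmem, rfl⟩)⟩

theorem closure_range_embed : closure (range (embed (𝔥 := 𝔥))) = Hhat b := by
  refine Subset.antisymm (closure_minimal ?_ (isCompact_Hhat b).isClosed) ?_
  · rintro _ ⟨h, rfl⟩
    exact embed_mem_Hhat b h
  · refine iUnion₂_subset fun ε w => ?_
    rintro _ ⟨p, hp, rfl⟩
    exact weylAct_mem_closure w (closure_mono (image_subset_range _ _) hp)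

end Compactification

/-! ### The smooth structure -/

section Manifold

variable (b : (rootSys 𝔥).Base)

theorem weylAct_mem_Hhat (w : Weyl 𝔥) {p : Ambient 𝔥} (hp : p ∈ Hhat b) : weylAct w p ∈ Hhat b := by
  rw [← closure_range_embed b] at hp ⊢
  exact weylAct_mem_closure w hp

theorem param_mem_Hhat (t : b.support → ℝ) : param b t ∈ Hhat b :=
  closure_range_embed b ▸ param_mem_closure b t

theorem weylAct_param_apply (w : Weyl 𝔥) (t : b.support → ℝ) (i : b.support) :
    weylAct w (param b t) (weylRoot 𝔥 w (negRoot 𝔥 i)) = ((t i : ℝ) : OnePoint ℝ) := by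
  rw [weylAct, weylRoot_inv_weylRoot, param_negRoot]

/-- The affine chart with the coordinates `χ_{-w α_i}`. -/
def weylChart (w : Weyl 𝔥) : OpenPartialHomeomorph (Hhat b) (b.support → ℝ) where
  toFun p i := affineCoord (p.1 (weylRoot 𝔥 w (negRoot 𝔥 i)))
  invFun t := ⟨weylAct w (param b t), weylAct_mem_Hhat b w (param_mem_Hhat b t)⟩
  source := {p | ∀ i : b.support, p.1 (weylRoot 𝔥 w (negRoot 𝔥 i)) ≠ OnePoint.infty}
  target := univ
  map_source' _ _ := mem_univ _
  map_target' t _ i := by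
    change weylAct w (param b t) _ ≠ _
    rw [weylAct_param_apply]
    exact OnePoint.coe_ne_infty _
  -- Translation by `w⁻¹` reduces this to the chart of the identity, where `param_affineCoord`
  -- applies.
  left_inv' p hp := by
    have hmem : weylAct w⁻¹ p.1 ∈ closure (range (embed (𝔥 := 𝔥))) := by
      rw [closure_range_embed b]
      exact weylAct_mem_Hhat b w⁻¹ p.2
    have hval : ∀ φ, weylAct w⁻¹ p.1 φ = p.1 (weylRoot 𝔥 w φ) := fun φ => by
      rw [weylAct, inv_inv]
    have h := param_affineCoord b hmem fun i => hval _ ▸ hp i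
    simp only [hval] at h
    exact Subtype.ext ((congrArg (weylAct w) h).trans (weylAct_weylAct_inv w p.1))
  right_inv' t _ := funext fun i => by
    change affineCoord (weylAct w (param b t) _) = t i
    rw [weylAct_param_apply, affineCoord_coe]
  open_source := by
    rw [ofPred_forall]
    exact isOpen_iInter_of_finite fun i =>
      (isOpen_compl_singleton (x := (OnePoint.infty : OnePoint ℝ))).preimage
        ((continuous_apply (weylRoot 𝔥 w (negRoot 𝔥 i))).comp
          (continuous_subtype_val (p := fun p : Ambient 𝔥 => p ∈ Hhat b)))
  open_target := isOpen_univ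
  continuousOn_toFun p hp := by
    refine (continuousAt_pi.mpr fun i => ?_).continuousWithinAt
    exact ContinuousAt.comp (f := fun p : Hhat b => p.1 (weylRoot 𝔥 w (negRoot 𝔥 i)))
      (continuousAt_affineCoord (hp i))
      ((continuous_apply _).comp continuous_subtype_val).continuousAt
  continuousOn_invFun :=
    (((continuous_weylAct w).comp (continuous_param b)).subtype_mk _).continuousOn

theorem weylChart_apply (w : Weyl 𝔥) (p : Hhat b) (i : b.support) :
    weylChart b w p i = affineCoord (p.1 (weylRoot 𝔥 w (negRoot 𝔥 i))) := rfl

theorem coe_weylChart_symm (w : Weyl 𝔥) (t : b.support → ℝ) :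
    ((weylChart b w).symm t : Ambient 𝔥) = weylAct w (param b t) := rfl

theorem exists_mem_weylChart_source (p : Hhat b) : ∃ w : Weyl 𝔥, p ∈ (weylChart b w).source := by
  obtain ⟨p, hp⟩ := p
  obtain ⟨ε, w, q, hq, rfl⟩ := mem_iUnion₂.mp hp
  rw [closedChamber_eq] at hq
  obtain ⟨t, -, rfl⟩ := hq
  refine ⟨w, fun i => ?_⟩
  change weylAct w (param b t) _ ≠ _
  rw [weylAct_param_apply]
  exact OnePoint.coe_ne_infty _

instance : ChartedSpace (b.support → ℝ) (Hhat b) where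
  atlas := range (weylChart b)
  chartAt p := weylChart b (exists_mem_weylChart_source b p).choose
  mem_chart_source p := (exists_mem_weylChart_source b p).choose_spec
  chart_mem_atlas _ := mem_range_self _

instance : IsManifold 𝓘(ℝ, b.support → ℝ) ∞ (Hhat b) := by
  refine isManifold_of_contDiffOn _ _ _ ?_
  rintro _ _ ⟨v, rfl⟩ ⟨w, rfl⟩ t ⟨ht, -⟩
  have hmem : (weylChart b v).symm t ∈ (weylChart b w).source := ht.2
  refine ContDiffAt.contDiffWithinAt (contDiffAt_pi.mpr fun i => ?_)
  -- The transition from `v` to `w` reads the coordinates of `param` at the roots `v⁻¹ w (-α_i)`,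
  -- finite on the overlap.
  exact contDiffAt_affineCoord_param b (hmem i)

instance : MulAction (Weyl 𝔥) (Hhat b) where
  smul w p := ⟨weylAct w p.1, weylAct_mem_Hhat b w p.2⟩
  one_smul p := Subtype.ext (weylAct_one p.1)
  mul_smul v w p := Subtype.ext (weylAct_mul v w p.1)

theorem coe_smul (w : Weyl 𝔥) (p : Hhat b) : ((w • p : Hhat b) : Ambient 𝔥) = weylAct w p := rfl

theorem weylChart_mem_maximalAtlas (w : Weyl 𝔥) :
    weylChart b w ∈ IsManifold.maximalAtlas 𝓘(ℝ, b.support → ℝ) ∞ (Hhat b) :=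
  IsManifold.subset_maximalAtlas (mem_range_self w)

/-- Between the charts of `v` and `w * v`, the action of `w` is the identity of `ℝ^l`. The same
holds for `w⁻¹`, so the action is by diffeomorphisms. -/
theorem contMDiff_smul (w : Weyl 𝔥) :
    ContMDiff 𝓘(ℝ, b.support → ℝ) 𝓘(ℝ, b.support → ℝ) ∞ (fun p : Hhat b => w • p) := by
  intro p
  obtain ⟨v, hv⟩ := exists_mem_weylChart_source b p
  have h1 := contMDiffOn_of_mem_maximalAtlas (weylChart_mem_maximalAtlas b v)
  have h2 := contMDiffOn_symm_of_mem_maximalAtlas (weylChart_mem_maximalAtlas b (w * v))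
  have h3 := h2.comp h1 fun _ _ => mem_univ _
  have hnhds := (weylChart b v).open_source.mem_nhds hv
  refine (h3.contMDiffAt hnhds).congr_of_eventuallyEq ?_
  filter_upwards [hnhds] with q hq
  refine Subtype.ext ?_
  have hq' := congrArg Subtype.val ((weylChart b v).left_inv hq)
  rw [coe_weylChart_symm] at hq'
  rw [Function.comp_apply, coe_weylChart_symm, weylAct_mul, hq', coe_smul]

theorem trans_mem_maximalAtlas {M E : Type*} [TopologicalSpace M] [NormedAddCommGroup E]
    [NormedSpace ℝ E] [ChartedSpace E M] [IsManifold 𝓘(ℝ, E) ∞ M]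
    {e : OpenPartialHomeomorph M E} (he : e ∈ IsManifold.maximalAtlas 𝓘(ℝ, E) ∞ M)
    {a : OpenPartialHomeomorph E E} (ha : a ∈ contDiffGroupoid ∞ 𝓘(ℝ, E)) :
    e.trans a ∈ IsManifold.maximalAtlas 𝓘(ℝ, E) ∞ M := by
  intro e' he'
  obtain ⟨h1, h2⟩ := he e' he'
  constructor
  · rw [OpenPartialHomeomorph.trans_symm_eq_symm_trans_symm, OpenPartialHomeomorph.trans_assoc]
    exact (contDiffGroupoid ∞ 𝓘(ℝ, E)).trans ((contDiffGroupoid ∞ 𝓘(ℝ, E)).symm ha) h1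
  · rw [← OpenPartialHomeomorph.trans_assoc]
    exact (contDiffGroupoid ∞ 𝓘(ℝ, E)).trans h2 ha

theorem boxHomeo_mem_contDiffGroupoid (ε : Signs b) :
    (boxHomeo b ε).toOpenPartialHomeomorph ∈ contDiffGroupoid ∞ 𝓘(ℝ, b.support → ℝ) := by
  rw [contDiffGroupoid, mem_groupoid_of_pregroupoid]
  constructor
  · refine ContDiff.contDiffOn (contDiff_pi.mpr fun i => ?_)
    exact (contDiff_const.mul (contDiff_apply ℝ ℝ i)).sub contDiff_const
  · refine ContDiff.contDiffOn (contDiff_pi.mpr fun i => ?_)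
    exact contDiff_const.mul (((contDiff_apply ℝ ℝ i).add contDiff_const).div_const 2)

theorem chamberInHhat_eq (ε : Signs b) :
    chamberInHhat b ε = (weylChart b 1).symm '' box b ε := by
  ext p
  rw [chamberInHhat, mem_ofPred_eq, closedChamber_eq]
  constructor
  · rintro ⟨t, ht, hp⟩
    exact ⟨t, ht, Subtype.ext (by rw [coe_weylChart_symm, weylAct_one, hp])⟩
  · rintro ⟨t, ht, rfl⟩
    exact ⟨t, ht, by rw [coe_weylChart_symm, weylAct_one]⟩

theorem chamberInHhat_subset_source (ε : Signs b) :
    chamberInHhat b ε ⊆ (weylChart b 1).source := by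
  rw [chamberInHhat_eq]
  rintro _ ⟨t, -, rfl⟩
  exact (weylChart b 1).map_target (mem_univ t)

theorem weylChart_image_chamberInHhat (ε : Signs b) :
    weylChart b 1 '' chamberInHhat b ε = box b ε := by
  rw [chamberInHhat_eq, ← image_comp]
  refine (image_congr fun t _ => ?_).trans (image_id _)
  exact (weylChart b 1).right_inv (mem_univ t)

end Manifold

end

end TodaVariety

theorem proposition2p1 {𝔤 : Type*} [LieRing 𝔤] [LieAlgebra ℝ 𝔤] [FiniteDimensional ℝ 𝔤]
    [LieAlgebra.IsSemisimple ℝ 𝔤]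
    (𝔥 : LieSubalgebra ℝ 𝔤) [𝔥.IsCartanSubalgebra] [LieModule.IsTriangularizable ℝ 𝔥 𝔤]
    (b : (TodaVariety.rootSys 𝔥).Base) :
    -- the closure is obtained by adding the pieces of the subsystems
    (∀ ε : TodaVariety.Signs b, TodaVariety.closedChamber b ε =
      ⋃ A : Set b.support, TodaVariety.subEmbed b A '' TodaVariety.subChamber b A ε) ∧
    -- and it is homeomorphic to the cube
    (∀ ε : TodaVariety.Signs b, Nonempty
      (TodaVariety.closedChamber b ε ≃ₜ Set.Icc (-1 : b.support → ℝ) 1)) ∧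
    -- `Ĥ_ℝ` is a compactification of `H_ℝ`
    IsCompact (TodaVariety.Hhat b) ∧
    Function.Injective (TodaVariety.embed (𝔥 := 𝔥)) ∧
    closure (Set.range (TodaVariety.embed (𝔥 := 𝔥))) = TodaVariety.Hhat b ∧
    -- the Weyl group acts on `H_ℝ` through the characters
    (∀ w : TodaVariety.Weyl 𝔥, TodaVariety.weylAct w '' Set.range TodaVariety.embed =
      Set.range TodaVariety.embed) ∧
    -- `Ĥ_ℝ` is a smooth manifold, and this action extends to an action by diffeomorphisms
    ∃ (_ : ChartedSpace (b.support → ℝ) (TodaVariety.Hhat b))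
      (_ : MulAction (TodaVariety.Weyl 𝔥) (TodaVariety.Hhat b)),
      IsManifold 𝓘(ℝ, b.support → ℝ) ∞ (TodaVariety.Hhat b) ∧
      (∀ (w : TodaVariety.Weyl 𝔥) (p : TodaVariety.Hhat b),
        ((w • p : TodaVariety.Hhat b) : TodaVariety.Ambient 𝔥) =
          TodaVariety.weylAct w (p : TodaVariety.Ambient 𝔥)) ∧
      (∀ w : TodaVariety.Weyl 𝔥, ContMDiff 𝓘(ℝ, b.support → ℝ) 𝓘(ℝ, b.support → ℝ) ∞
        (fun p : TodaVariety.Hhat b => w • p)) ∧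
      -- the functions `χ_{-α_i}` form a chart around the closed chambers
      (∃ e ∈ IsManifold.maximalAtlas 𝓘(ℝ, b.support → ℝ) ∞ (TodaVariety.Hhat b),
        (∀ p ∈ e.source, ∀ i : b.support,
          (p : TodaVariety.Ambient 𝔥) (TodaVariety.negRoot 𝔥 i) = ((e p i : ℝ) : OnePoint ℝ)) ∧
        ∀ ε : TodaVariety.Signs b, TodaVariety.chamberInHhat b ε ⊆ e.source ∧
          e '' TodaVariety.chamberInHhat b ε =
            {t | ∀ i, 0 ≤ ((ε i : ℤ) : ℝ) * t i ∧ ((ε i : ℤ) : ℝ) * t i ≤ 1}) ∧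
      -- and each closed chamber is diffeomorphic to the cube
      (∀ ε : TodaVariety.Signs b,
        ∃ e ∈ IsManifold.maximalAtlas 𝓘(ℝ, b.support → ℝ) ∞ (TodaVariety.Hhat b),
          TodaVariety.chamberInHhat b ε ⊆ e.source ∧
          e '' TodaVariety.chamberInHhat b ε = Set.Icc (-1) 1) := by
  refine ⟨TodaVariety.closedChamber_eq_iUnion b, TodaVariety.nonempty_closedChamber_homeo b,
    TodaVariety.isCompact_Hhat b, TodaVariety.embed_injective, TodaVariety.closure_range_embed b,
    TodaVariety.weylAct_image_range_embed, inferInstance, inferInstance, inferInstance,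
    TodaVariety.coe_smul b, TodaVariety.contMDiff_smul b, ?_, fun ε => ?_⟩
  · refine ⟨TodaVariety.weylChart b 1, TodaVariety.weylChart_mem_maximalAtlas b 1,
      fun p hp i => ?_, fun ε => ⟨TodaVariety.chamberInHhat_subset_source b ε,
        TodaVariety.weylChart_image_chamberInHhat b ε⟩⟩
    rw [TodaVariety.weylChart_apply, TodaVariety.coe_affineCoord (hp i), TodaVariety.weylRoot_one]
  -- The chart by the `χ_{-α_i}` already gives a box; an affine change of coordinates depending on
  -- `ε` normalizes it to the cube.
  · refine ⟨(TodaVariety.weylChart b 1).trans (TodaVariety.boxHomeo b ε).toOpenPartialHomeomorph,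
      TodaVariety.trans_mem_maximalAtlas (TodaVariety.weylChart_mem_maximalAtlas b 1)
        (TodaVariety.boxHomeo_mem_contDiffGroupoid b ε), fun p hp =>
        ⟨TodaVariety.chamberInHhat_subset_source b ε hp, Set.mem_univ _⟩, ?_⟩
    rw [OpenPartialHomeomorph.coe_trans, Set.image_comp,
      TodaVariety.weylChart_image_chamberInHhat]
    exact TodaVariety.boxHomeo_image b ε
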